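/- Let $n\ge 2$, let $\Omega\subset\mathbb R^n$ be a non-empty open convex set, and let $F=F(x,y)$ be its Funk metric: the positive function on $T\Omega\setminus\{0\}=\Omega\times(\mathbb R^n\setminus\{0\})$ with $x+y/F(x,y)\in\partial\Omega$, assumed to be a Finsler metric on $T\Omega\setminus\{0\}$. Here a Finsler metric on an open conical region $\mathcal C$ is a $C^\infty$ function $L$ on $\mathcal C$, positively homogeneous of degree two in $y$, with $g_{ij}:=(\tfrac12L)_{y^iy^j}$ non-degenerate; a positive $F$ of degree one is called a Finsler metric if $L=F^2$ is one. The spray induced by $L$ has the coefficients $G^i=\tfrac14g^{il}\{L_{x^ky^l}y^k-L_{x^l}\}$. Let $\mathbf G$ be the spray induced by $F$, and for a real constant $c$ let $$\bar G^i(x,y):=G^i(x,y)+cF(x,-y)\,y^i ,$$ which are the coefficients of a spray $\bar{\mathbf G}$ on $T\Omega\setminus\{0\}$ (smooth, positively homogeneous of degree two). The Riemann curvature of a spray $\mathbf G$ is $$R^i_{\ k}=2\partial_{x^k}G^i-y^j\partial_{x^j}\partial_{y^k}G^i+2G^j\partial_{y^j}\partial_{y^k}G^i-(\partial_{y^j}G^i)(\partial_{y^k}G^j).$$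 The spray is of scalar curvature if $R^i_{\ k}=R\,\delta^i_k-\tau_ky^i$ for some smooth functions $R,\tau_k$ of $(x,y)$, positively homogeneous in $y$ of degrees $2$ and $1$; it is of isotropic curvature if moreover $R_{y^i}=2\tau_i$, and of constant curvature if it is of scalar curvature with $\tau_{i;k}=0$, where $\tau_{i;k}=\partial_{x^k}\tau_i-(\partial_{y^k}G^r)\partial_{y^r}\tau_i-\tau_r\,\partial_{y^k}\partial_{y^i}G^r$. A spray on $\Omega$ is metrizable on an open set $U\subset\Omega$ if there are a conical region $\mathcal C$ of $TU\setminus\{0\}$ (an open set, invariant under $y\mapsto ty$ for $t>0$, with non-empty fibre over every point of $U$) and a Finsler metric on $\mathcal C$ inducing the spray on $\mathcal C$; it is locally metrizable if every point of $\Omega$ has an open neighbourhood $U\subset\Omega$ on which it is metrizable. Then: (i) $\bar{\mathbf G}$ is of isotropic curvature, and it is of constant curvature if and only if $c=0$ or $c=-\tfrac12$. (ii) $\bar{\mathbf G}$ is locally metrizable if and only if $c=0$ or $c=-\tfrac12$, and it is metrizable on $\Omega$ if and only if $c=0$ or $c=-\tfrac12$. If $c=0$, then $\bar{\mathbf G}$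 is induced on $T\Omega\setminus\{0\}$ by $F$; if $c=-\tfrac12$, then the Klein metric $\bar F(x,y):=\tfrac12[F(x,y)+F(x,-y)]$ is a Finsler metric on $T\Omega\setminus\{0\}$ and induces $\bar{\mathbf G}$. -/

import Mathlib

open scoped ContDiff

noncomputable section

/-- Coordinate space `ℝⁿ`. Points `x` and tangent vectors `y` of a domain of `ℝⁿ` are both elements
of this space, and the tangent bundle of `U ⊆ ℝⁿ` is `U × ℝⁿ`. -/
abbrev Vec (n : ℕ) : Type := Fin n → ℝ

variable {n : ℕ}

/-- The slit tangent bundle `TU \ {0}`. -/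
def slitTangent (U : Set (Vec n)) : Set (Vec n × Vec n) :=
  {p | p.1 ∈ U ∧ p.2 ≠ 0}

/-- Conical regions `𝒞` of `TU \ {0}`: open subsets invariant under positive scaling of `y`, whose
fibre over every point of `U` is non-empty. -/
structure IsConicalRegion (U : Set (Vec n)) (C : Set (Vec n × Vec n)) : Prop where
  isOpen : IsOpen C
  subset : C ⊆ slitTangent U
  smul_mem : ∀ x y, (x, y) ∈ C → ∀ t : ℝ, 0 < t → (x, t • y) ∈ C
  fibre_nonempty : ∀ x ∈ U, ∃ y, (x, y) ∈ C

/-- `∂f/∂xᵏ` for a function `f(x, y)`. -/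
def dX (k : Fin n) (f : Vec n → Vec n → ℝ) (x y : Vec n) : ℝ :=
  fderiv ℝ (fun z => f z y) x (Pi.single k 1)

/-- `∂f/∂yᵏ` for a function `f(x, y)`. -/
def dY (k : Fin n) (f : Vec n → Vec n → ℝ) (x y : Vec n) : ℝ :=
  fderiv ℝ (fun w => f x w) y (Pi.single k 1)

/-- `f` is `C^∞` on `C`, as a function of `(x, y)`. -/
def SmoothOnTangent (C : Set (Vec n × Vec n)) (f : Vec n → Vec n → ℝ) : Prop :=
  ContDiffOn ℝ ∞ (fun p : Vec n × Vec n => f p.1 p.2) C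

/-- `f` is positively homogeneous of degree `d` in `y` on `C`. -/
def PosHomogOn (C : Set (Vec n × Vec n)) (d : ℕ) (f : Vec n → Vec n → ℝ) : Prop :=
  ∀ x y, (x, y) ∈ C → ∀ t : ℝ, 0 < t → f x (t • y) = t ^ d * f x y

/-- The functions `Gⁱ(x, y)` are the coefficients of a spray on the conical region `C`. -/
def IsSpray (C : Set (Vec n × Vec n)) (G : Fin n → Vec n → Vec n → ℝ) : Prop :=
  ∀ i, SmoothOnTangent C (G i) ∧ PosHomogOn C 2 (G i)

/-- The Riemann curvature `Rⁱₖ` of the spray `G`. -/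
def riemannCurv (G : Fin n → Vec n → Vec n → ℝ) (i k : Fin n) (x y : Vec n) : ℝ :=
  2 * dX k (G i) x y - ∑ j, y j * dX j (dY k (G i)) x y
    + 2 * ∑ j, G j x y * dY j (dY k (G i)) x y
    - ∑ j, dY j (G i) x y * dY k (G j) x y

/-- The Berwald horizontal derivative
`T_{i;k} = ∂ₖTᵢ - Gʳₖ ∂Tᵢ/∂yʳ - Tᵣ Gʳᵢₖ`, where `Gʳₖ = ∂Gʳ/∂yᵏ` and `Gʳᵢₖ = ∂²Gʳ/∂yᵏ∂yⁱ`. -/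
def horizDeriv (G : Fin n → Vec n → Vec n → ℝ) (T : Fin n → Vec n → Vec n → ℝ)
    (i k : Fin n) (x y : Vec n) : ℝ :=
  dX k (T i) x y - ∑ r, dY k (G r) x y * dY r (T i) x y
    - ∑ r, T r x y * dY k (dY i (G r)) x y

/-- `G` is of scalar curvature on `C`, with `Rⁱₖ = R δⁱₖ - τₖ yⁱ`. -/
structure HasScalarCurvature (C : Set (Vec n × Vec n)) (G : Fin n → Vec n → Vec n → ℝ)
    (R : Vec n → Vec n → ℝ) (τ : Fin n → Vec n → Vec n → ℝ) : Prop where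
  smooth_R : SmoothOnTangent C R
  smooth_τ : ∀ k, SmoothOnTangent C (τ k)
  homog_R : PosHomogOn C 2 R
  homog_τ : ∀ k, PosHomogOn C 1 (τ k)
  curv_eq : ∀ x y, (x, y) ∈ C → ∀ i k,
    riemannCurv G i k x y = R x y * (if i = k then 1 else 0) - τ k x y * y i

/-- `G` is of isotropic curvature on `C`: scalar curvature with `∂R/∂yⁱ = 2τᵢ`. -/
def IsIsotropicCurvature (C : Set (Vec n × Vec n)) (G : Fin n → Vec n → Vec n → ℝ) : Prop :=
  ∃ (R : Vec n → Vec n → ℝ) (τ : Fin n → Vec n → Vec n → ℝ), HasScalarCurvature C G R τ ∧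
    ∀ x y, (x, y) ∈ C → ∀ i, dY i R x y = 2 * τ i x y

/-- `G` is of constant curvature on `C`: scalar curvature with `τ_{i;k} = 0`. -/
def IsConstantCurvature (C : Set (Vec n × Vec n)) (G : Fin n → Vec n → Vec n → ℝ) : Prop :=
  ∃ (R : Vec n → Vec n → ℝ) (τ : Fin n → Vec n → Vec n → ℝ), HasScalarCurvature C G R τ ∧
    ∀ x y, (x, y) ∈ C → ∀ i k, horizDeriv G τ i k x y = 0

/-- The fundamental tensor `g_{ij} = (L/2)_{yⁱyʲ}`. -/
def fundTensor (L : Vec n → Vec n → ℝ) (x y : Vec n) : Matrix (Fin n) (Fin n) ℝ :=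
  Matrix.of fun i j => dY j (dY i (fun x' y' => L x' y' / 2)) x y

/-- `L` is a (possibly singular) Finsler metric on the conical region `C`: it is `C^∞`, positively
homogeneous of degree two, and its fundamental tensor is non-degenerate. Its sign is unrestricted;
a metric `F` of degree one corresponds to `L = F²`. -/
structure IsFinslerMetric (C : Set (Vec n × Vec n)) (L : Vec n → Vec n → ℝ) : Prop where
  smooth : SmoothOnTangent C L
  homog : PosHomogOn C 2 L
  nondegenerate : ∀ x y, (x, y) ∈ C → (fundTensor L x y).det ≠ 0

/-- The coefficients `Gⁱ = ¼ gⁱˡ (L_{xᵏyˡ} yᵏ - L_{xˡ})` of the spray of a Finsler metric `L`. -/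
def finslerSpray (L : Vec n → Vec n → ℝ) (i : Fin n) (x y : Vec n) : ℝ :=
  1 / 4 * ∑ l, (fundTensor L x y)⁻¹ i l * (∑ k, dX k (dY l L) x y * y k - dX l L x y)

/-- `L` is a Finsler metric on `C` that induces the spray `G` there. -/
def Induces (C : Set (Vec n × Vec n)) (L : Vec n → Vec n → ℝ)
    (G : Fin n → Vec n → Vec n → ℝ) : Prop :=
  IsFinslerMetric C L ∧ ∀ x y, (x, y) ∈ C → ∀ i, G i x y = finslerSpray L i x y

/-- `G` is Finsler-metrizable on `U`: some Finsler metric on some conical region over `U`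
induces `G`. -/
def MetrizableOn (U : Set (Vec n)) (G : Fin n → Vec n → Vec n → ℝ) : Prop :=
  ∃ (C : Set (Vec n × Vec n)) (L : Vec n → Vec n → ℝ), IsConicalRegion U C ∧ Induces C L G

/-- `G` is locally Finsler-metrizable on `Ω`: every point of `Ω` has an open neighbourhood on
which `G` is metrizable. -/
def LocallyMetrizableOn (Ω : Set (Vec n)) (G : Fin n → Vec n → Vec n → ℝ) : Prop :=
  ∀ x ∈ Ω, ∃ U : Set (Vec n), IsOpen U ∧ x ∈ U ∧ U ⊆ Ω ∧ MetrizableOn U G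

/-- `F` is the Funk metric of the convex domain `Ω`: the positive function on `TΩ \ {0}` with
`x + y / F(x, y) ∈ ∂Ω`, assumed to be a Finsler metric. -/
structure IsFunkMetric (Ω : Set (Vec n)) (F : Vec n → Vec n → ℝ) : Prop where
  pos : ∀ x y, (x, y) ∈ slitTangent Ω → 0 < F x y
  mem_frontier : ∀ x y, (x, y) ∈ slitTangent Ω → x + (F x y)⁻¹ • y ∈ frontier Ω
  finsler : IsFinslerMetric (slitTangent Ω) (fun x y => F x y ^ 2)

/-- The functions `Ḡⁱ(y) = Gⁱ(y) + c F(-y) yⁱ`, where `G` is the spray of `F`. -/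
def modifiedSpray (F : Vec n → Vec n → ℝ) (c : ℝ) (i : Fin n) (x y : Vec n) : ℝ :=
  finslerSpray (fun x' y' => F x' y' ^ 2) i x y + c * F x (-y) * y i

/-- The Klein metric `F̄(y) = [F(y) + F(-y)] / 2`. -/
def kleinMetric (F : Vec n → Vec n → ℝ) (x y : Vec n) : ℝ :=
  (F x y + F x (-y)) / 2

end

/-! Write `a` for `F(x, y)` and `b` for `F(x, -y)`. The point `p = x + y / F(x, y)` of the boundary
is also the exit point of the ray from any other `z ∈ Ω` towards `p`, so `F(z, p - z) = 1`;
differentiating in `z` gives `a_{xᵏ} = a a_{yᵏ}` and, after reversal, `b_{xᵏ} = -b b_{yᵏ}`.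
Everything except the non-degeneracy of the Klein metric follows from these two equations,
homogeneity and positivity.

They show that the spray is `P yⁱ` with `P = a/2 + c b`. Put `Ξ = P² - yʲ P_{xʲ} = -a²/4 + c a b +
(c² + c) b²`. Then `P_{xᵏ} = P P_{yᵏ} - Ξ_{yᵏ}/2`, which yields `Rⁱₖ = Ξ δⁱₖ - (Ξ_{yᵏ}/2) yⁱ`:
isotropic curvature. The horizontal derivative of `Ξ` is `-c(2c+1) A_{yᵏ}` with `A = a b² +
(2/3)(c+1) b³` (`horizontal_ricciScalar`), so `τ_{i;k}` is a multiple of the `y`-Hessian of `A`. By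
Euler's relation that Hessian vanishes identically only if `A` does, which is excluded by
`not_forall_cubic_eq_zero`.

For metrizability, a metric `L` inducing `P yⁱ` is horizontally constant. Commuting its
`x`-derivatives shows that `Ξ / L` does not depend on `y`. Its `x`-derivative is then also free of
`y`, and equals `-c(2c+1) A_{yᵏ} / L`. If `c(2c+1) ≠ 0`, this forces the Hessian of `L` to have rank
at most one wherever `A L ≠ 0`, contradicting non-degeneracy as `n ≥ 2`
(`eq_zero_of_horizontally_constant`). Conversely, `F²` and the squared Klein metric are horizontally
constant for `c = 0` and `c = -1/2`. The Klein metric is non-degenerate because convexity of `Ω`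
makes the Hessians of `a` and `b` positive semidefinite, while that of `a` has only the radial
kernel. -/

noncomputable section

variable {n : ℕ}

/-! ### Calculus of partial derivatives in `(x, y)` and Euler's relation -/

section Calculus

variable {C : Set (Vec n × Vec n)} {f g : Vec n → Vec n → ℝ}

namespace SmoothOnTangent

lemma add (hf : SmoothOnTangent C f) (hg : SmoothOnTangent C g) :
    SmoothOnTangent C (fun x y => f x y + g x y) := ContDiffOn.add hf hg

lemma sub (hf : SmoothOnTangent C f) (hg : SmoothOnTangent C g) :
    SmoothOnTangent C (fun x y => f x y - g x y) := ContDiffOn.sub hf hg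

lemma mul (hf : SmoothOnTangent C f) (hg : SmoothOnTangent C g) :
    SmoothOnTangent C (fun x y => f x y * g x y) := ContDiffOn.mul hf hg

lemma const_mul (r : ℝ) (hf : SmoothOnTangent C f) :
    SmoothOnTangent C (fun x y => r * f x y) := ContDiffOn.mul contDiffOn_const hf

lemma sum {ι : Type*} {s : Finset ι} {u : ι → Vec n → Vec n → ℝ}
    (hu : ∀ i, SmoothOnTangent C (u i)) :
    SmoothOnTangent C (fun x y => ∑ i ∈ s, u i x y) :=
  ContDiffOn.sum fun i _ => hu i

lemma const (r : ℝ) : SmoothOnTangent C (fun _ _ => r) := contDiffOn_const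

lemma coord (i : Fin n) : SmoothOnTangent C (fun _ y => y i) :=
  ((contDiff_apply ℝ ℝ i).comp contDiff_snd).contDiffOn

lemma congr (hf : SmoothOnTangent C f) (h : ∀ x y, (x, y) ∈ C → g x y = f x y) :
    SmoothOnTangent C g := ContDiffOn.congr hf fun p hp => h p.1 p.2 hp

lemma mono {C' : Set (Vec n × Vec n)} (hf : SmoothOnTangent C f) (h : C' ⊆ C) :
    SmoothOnTangent C' f := ContDiffOn.mono hf h

lemma differentiableAt (hC : IsOpen C) (hf : SmoothOnTangent C f) {x y : Vec n}
    (h : (x, y) ∈ C) : DifferentiableAt ℝ (fun p : Vec n × Vec n => f p.1 p.2) (x, y) :=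
  (ContDiffOn.contDiffAt hf (hC.mem_nhds h)).differentiableAt (by simp)

lemma differentiableAt_fst (hC : IsOpen C) (hf : SmoothOnTangent C f) {x y : Vec n}
    (h : (x, y) ∈ C) : DifferentiableAt ℝ (fun z => f z y) x :=
  (hf.differentiableAt hC h).comp x (f := fun z => (z, y)) (by fun_prop)

lemma differentiableAt_snd (hC : IsOpen C) (hf : SmoothOnTangent C f) {x y : Vec n}
    (h : (x, y) ∈ C) : DifferentiableAt ℝ (fun w => f x w) y :=
  (hf.differentiableAt hC h).comp y (f := fun w => (x, w)) (by fun_prop)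

end SmoothOnTangent

/-- The derivative of `f(x, y)` in the direction `w` of the product space. -/
def dirDeriv (w : Vec n × Vec n) (f : Vec n → Vec n → ℝ) (x y : Vec n) : ℝ :=
  fderiv ℝ (fun p : Vec n × Vec n => f p.1 p.2) (x, y) w

lemma dX_eq_dirDeriv (hC : IsOpen C) (hf : SmoothOnTangent C f) {x y : Vec n}
    (h : (x, y) ∈ C) (k : Fin n) : dX k f x y = dirDeriv (Pi.single k 1, 0) f x y := by
  have h1 : HasFDerivAt (fun z : Vec n => (z, y)) (ContinuousLinearMap.inl ℝ (Vec n) (Vec n)) x :=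
    hasFDerivAt_prodMk_left x y
  have h2 := (hf.differentiableAt hC h).hasFDerivAt.comp x h1
  have h3 := h2.fderiv
  simp only [Function.comp_def] at h3
  simp [dX, dirDeriv, h3]

lemma dY_eq_dirDeriv (hC : IsOpen C) (hf : SmoothOnTangent C f) {x y : Vec n}
    (h : (x, y) ∈ C) (k : Fin n) : dY k f x y = dirDeriv (0, Pi.single k 1) f x y := by
  have h1 : HasFDerivAt (fun z : Vec n => (x, z)) (ContinuousLinearMap.inr ℝ (Vec n) (Vec n)) y :=
    hasFDerivAt_prodMk_right x y
  have h2 := (hf.differentiableAt hC h).hasFDerivAt.comp y h1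
  have h3 := h2.fderiv
  simp only [Function.comp_def] at h3
  simp [dY, dirDeriv, h3]

lemma SmoothOnTangent.dirDeriv (hC : IsOpen C) (hf : SmoothOnTangent C f) (w : Vec n × Vec n) :
    SmoothOnTangent C (dirDeriv w f) := by
  have h : ContDiffOn ℝ ∞ (fderiv ℝ (fun p : Vec n × Vec n => f p.1 p.2)) C :=
    ContDiffOn.fderiv_of_isOpen hf hC (by simp)
  exact h.clm_apply contDiffOn_const

lemma SmoothOnTangent.dX (hC : IsOpen C) (hf : SmoothOnTangent C f) (k : Fin n) :
    SmoothOnTangent C (dX k f) :=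
  (hf.dirDeriv hC _).congr fun _ _ h => dX_eq_dirDeriv hC hf h k

lemma SmoothOnTangent.dY (hC : IsOpen C) (hf : SmoothOnTangent C f) (k : Fin n) :
    SmoothOnTangent C (dY k f) :=
  (hf.dirDeriv hC _).congr fun _ _ h => dY_eq_dirDeriv hC hf h k

lemma dirDeriv_congr (hC : IsOpen C) (hfg : ∀ x y, (x, y) ∈ C → f x y = g x y) {x y : Vec n}
    (h : (x, y) ∈ C) (w : Vec n × Vec n) : dirDeriv w f x y = dirDeriv w g x y := by
  have : (fun p : Vec n × Vec n => f p.1 p.2) =ᶠ[nhds (x, y)] fun p => g p.1 p.2 := by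
    filter_upwards [hC.mem_nhds h] with p hp using hfg _ _ hp
  simp only [dirDeriv, this.fderiv_eq]

/-- All mixed partials are directional derivatives of one function on the product space, so every
commutation rule for `dX` and `dY` is an instance of the symmetry of its second derivative. -/
lemma dirDeriv_comm (hC : IsOpen C) (hf : SmoothOnTangent C f) {x y : Vec n}
    (h : (x, y) ∈ C) (v w : Vec n × Vec n) :
    dirDeriv v (dirDeriv w f) x y = dirDeriv w (dirDeriv v f) x y := by
  have hs : IsSymmSndFDerivAt ℝ (fun p : Vec n × Vec n => f p.1 p.2) (x, y) :=
    (ContDiffOn.contDiffAt hf (hC.mem_nhds h)).isSymmSndFDerivAt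
      (by rw [minSmoothness_of_isRCLikeNormedField]; exact WithTop.coe_le_coe.2 le_top)
  have hd : DifferentiableAt ℝ (fderiv ℝ (fun p : Vec n × Vec n => f p.1 p.2)) (x, y) :=
    ((ContDiffOn.fderiv_of_isOpen hf hC (m := ∞) (by simp)).contDiffAt
      (hC.mem_nhds h)).differentiableAt (by simp)
  have key : ∀ v w : Vec n × Vec n, dirDeriv v (dirDeriv w f) x y =
      fderiv ℝ (fderiv ℝ (fun p : Vec n × Vec n => f p.1 p.2)) (x, y) v w := by
    intro v w
    simp only [dirDeriv]
    rw [fderiv_clm_apply hd (differentiableAt_const _)]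
    simp
  rw [key, key, hs.eq]

/-- An operator on functions of `(x, y)` that acts as a derivation on the smooth functions
on `C`. -/
structure IsDerivation (C : Set (Vec n × Vec n))
    (D : (Vec n → Vec n → ℝ) → Vec n → Vec n → ℝ) : Prop where
  smooth : ∀ {f}, SmoothOnTangent C f → SmoothOnTangent C (D f)
  congr : ∀ {f g}, (∀ x y, (x, y) ∈ C → f x y = g x y) → ∀ {x y}, (x, y) ∈ C → D f x y = D g x y
  add : ∀ {f g}, SmoothOnTangent C f → SmoothOnTangent C g → ∀ {x y}, (x, y) ∈ C →
    D (fun x y => f x y + g x y) x y = D f x y + D g x y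
  mul : ∀ {f g}, SmoothOnTangent C f → SmoothOnTangent C g → ∀ {x y}, (x, y) ∈ C →
    D (fun x y => f x y * g x y) x y = D f x y * g x y + f x y * D g x y
  const_mul : ∀ (r : ℝ) {f}, SmoothOnTangent C f → ∀ {x y}, (x, y) ∈ C →
    D (fun x y => r * f x y) x y = r * D f x y

lemma isDerivation_dX (hC : IsOpen C) (k : Fin n) : IsDerivation C (dX k) where
  smooth hf := hf.dX hC k
  congr {f g} hfg {x y} h := by
    have : (fun z => f z y) =ᶠ[nhds x] fun z => g z y := by
      have hc : Continuous fun z : Vec n => (z, y) := by fun_prop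
      filter_upwards [(hC.preimage hc).mem_nhds h] with z hz using hfg _ _ hz
    simp only [dX, this.fderiv_eq]
  add {f g} hf hg {x y} h := by
    simp only [dX]
    rw [fderiv_fun_add (hf.differentiableAt_fst hC h) (hg.differentiableAt_fst hC h)]
    simp
  mul {f g} hf hg {x y} h := by
    simp only [dX]
    rw [fderiv_fun_mul (hf.differentiableAt_fst hC h) (hg.differentiableAt_fst hC h)]
    simp
    ring
  const_mul r f hf {x y} h := by
    simp only [dX]
    rw [fderiv_const_mul (hf.differentiableAt_fst hC h)]
    simp

lemma isDerivation_dY (hC : IsOpen C) (k : Fin n) : IsDerivation C (dY k) where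
  smooth hf := hf.dY hC k
  congr {f g} hfg {x y} h := by
    have : (fun w => f x w) =ᶠ[nhds y] fun w => g x w := by
      have hc : Continuous fun w : Vec n => (x, w) := by fun_prop
      filter_upwards [(hC.preimage hc).mem_nhds h] with w hw using hfg _ _ hw
    simp only [dY, this.fderiv_eq]
  add {f g} hf hg {x y} h := by
    simp only [dY]
    rw [fderiv_fun_add (hf.differentiableAt_snd hC h) (hg.differentiableAt_snd hC h)]
    simp
  mul {f g} hf hg {x y} h := by
    simp only [dY]
    rw [fderiv_fun_mul (hf.differentiableAt_snd hC h) (hg.differentiableAt_snd hC h)]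
    simp
    ring
  const_mul r f hf {x y} h := by
    simp only [dY]
    rw [fderiv_const_mul (hf.differentiableAt_snd hC h)]
    simp

namespace IsDerivation

variable {D : (Vec n → Vec n → ℝ) → Vec n → Vec n → ℝ}

lemma sub (hD : IsDerivation C D) (hf : SmoothOnTangent C f) (hg : SmoothOnTangent C g)
    {x y : Vec n} (h : (x, y) ∈ C) :
    D (fun x y => f x y - g x y) x y = D f x y - D g x y := by
  have := hD.add hf (hg.const_mul (-1)) h
  rw [hD.const_mul (-1) hg h] at this
  rw [hD.congr (g := fun x y => f x y + -1 * g x y) (fun _ _ _ => by ring) h, this]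
  ring

lemma zero (hD : IsDerivation C D) {x y : Vec n} (h : (x, y) ∈ C) :
    D (fun _ _ => 0) x y = 0 := by
  have := hD.const_mul 0 (SmoothOnTangent.const 0) h
  simpa using this

lemma sum (hD : IsDerivation C D) {ι : Type*} (s : Finset ι) {u : ι → Vec n → Vec n → ℝ}
    (hu : ∀ i, SmoothOnTangent C (u i)) {x y : Vec n} (h : (x, y) ∈ C) :
    D (fun x y => ∑ i ∈ s, u i x y) x y = ∑ i ∈ s, D (u i) x y := by
  classical
  induction s using Finset.induction_on with
  | empty => simpa using hD.zero h
  | insert a s ha ih =>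
    simp only [Finset.sum_insert ha]
    rw [hD.add (hu a) (SmoothOnTangent.sum hu) h, ih]

end IsDerivation

lemma dX_coord (i k : Fin n) (x y : Vec n) : dX k (fun _ y => y i) x y = 0 := by
  simp [dX]

lemma dY_coord (i k : Fin n) (x y : Vec n) :
    dY k (fun _ y => y i) x y = if i = k then 1 else 0 := by
  have : HasFDerivAt (fun w : Vec n => w i) (ContinuousLinearMap.proj (R := ℝ) i) y :=
    (ContinuousLinearMap.proj (R := ℝ) i : Vec n →L[ℝ] ℝ).hasFDerivAt
  simp [dY, this.fderiv, Pi.single_apply]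

lemma dX_dY_comm (hC : IsOpen C) (hf : SmoothOnTangent C f) {x y : Vec n} (h : (x, y) ∈ C)
    (j k : Fin n) : dX j (dY k f) x y = dY k (dX j f) x y := by
  rw [dX_eq_dirDeriv hC (hf.dY hC k) h, dY_eq_dirDeriv hC (hf.dX hC j) h,
    dirDeriv_congr hC (fun _ _ h' => dY_eq_dirDeriv hC hf h' k) h,
    dirDeriv_congr hC (fun _ _ h' => dX_eq_dirDeriv hC hf h' j) h, dirDeriv_comm hC hf h]

lemma dY_comm (hC : IsOpen C) (hf : SmoothOnTangent C f) {x y : Vec n} (h : (x, y) ∈ C)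
    (j k : Fin n) : dY j (dY k f) x y = dY k (dY j f) x y := by
  rw [dY_eq_dirDeriv hC (hf.dY hC k) h, dY_eq_dirDeriv hC (hf.dY hC j) h,
    dirDeriv_congr hC (fun _ _ h' => dY_eq_dirDeriv hC hf h' k) h,
    dirDeriv_congr hC (fun _ _ h' => dY_eq_dirDeriv hC hf h' j) h, dirDeriv_comm hC hf h]

lemma dX_comm (hC : IsOpen C) (hf : SmoothOnTangent C f) {x y : Vec n} (h : (x, y) ∈ C)
    (j k : Fin n) : dX j (dX k f) x y = dX k (dX j f) x y := by
  rw [dX_eq_dirDeriv hC (hf.dX hC k) h, dX_eq_dirDeriv hC (hf.dX hC j) h,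
    dirDeriv_congr hC (fun _ _ h' => dX_eq_dirDeriv hC hf h' k) h,
    dirDeriv_congr hC (fun _ _ h' => dX_eq_dirDeriv hC hf h' j) h, dirDeriv_comm hC hf h]

lemma fderiv_snd_apply_eq_sum (x y v : Vec n) :
    fderiv ℝ (fun w => f x w) y v = ∑ k, v k * dY k f x y := by
  conv_lhs => rw [pi_eq_sum_univ' v]
  simp only [map_sum, map_smul, dY, smul_eq_mul]

lemma PosHomogOn.euler {d : ℕ} (hC : IsOpen C) (hf : SmoothOnTangent C f)
    (hd : PosHomogOn C d f) {x y : Vec n} (h : (x, y) ∈ C) :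
    ∑ k, y k * dY k f x y = d * f x y := by
  rw [← fderiv_snd_apply_eq_sum]
  have h1 : HasDerivAt (fun t : ℝ => t • y) y 1 := by
    simpa using (hasDerivAt_id (1 : ℝ)).smul_const y
  have h0 : HasFDerivAt (fun w => f x w) (fderiv ℝ (fun w => f x w) y) ((1 : ℝ) • y) := by
    rw [one_smul]
    exact (hf.differentiableAt_snd hC h).hasFDerivAt
  have h2 : HasDerivAt (fun t : ℝ => f x (t • y)) (fderiv ℝ (fun w => f x w) y y) 1 :=
    h0.comp_hasDerivAt (1 : ℝ) h1
  have h3 : HasDerivAt (fun t : ℝ => t ^ d * f x y) (d * f x y) 1 := by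
    simpa using (hasDerivAt_pow d (1 : ℝ)).mul_const (f x y)
  refine h2.unique (h3.congr_of_eventuallyEq ?_)
  filter_upwards [lt_mem_nhds (zero_lt_one (α := ℝ))] with t ht using hd x y h t ht

lemma PosHomogOn.dY {d : ℕ} (hC : IsOpen C) (hf : SmoothOnTangent C f)
    (hd : PosHomogOn C (d + 1) f) (k : Fin n) :
    PosHomogOn C d (dY k f) := by
  intro x y h t ht
  have h1 : fderiv ℝ (fun w => f x (t • w)) y = t • fderiv ℝ (fun w => f x w) (t • y) :=
    fderiv_comp_smul (f := fun w => f x w) t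
  have h2 : (fun w => f x (t • w)) =ᶠ[nhds y] fun w => t ^ (d + 1) • f x w := by
    have hc : Continuous fun w : Vec n => (x, w) := by fun_prop
    filter_upwards [(hC.preimage hc).mem_nhds h] with w hw using hd x w hw t ht
  have h3 : fderiv ℝ (fun w => t ^ (d + 1) • f x w) y = t ^ (d + 1) • fderiv ℝ (fun w => f x w) y :=
    fderiv_fun_const_smul (hf.differentiableAt_snd hC h) _
  rw [h2.fderiv_eq, h3] at h1
  have h4 := congrArg (fun l => l (Pi.single k 1)) h1
  simp only [smul_apply, smul_eq_mul] at h4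
  refine mul_left_cancel₀ ht.ne' ?_
  simp only [_root_.dY]
  rw [← h4]
  ring

end Calculus

/-! ### Sprays of the form `P yⁱ`: curvature, and metrics inducing them -/

section ProjectivelyFlat

variable {C : Set (Vec n × Vec n)} {P L Ξ A : Vec n → Vec n → ℝ}

lemma PosHomogOn.euler_dY {d : ℕ} {f : Vec n → Vec n → ℝ} (hC : IsOpen C)
    (hf : SmoothOnTangent C f) (hd : PosHomogOn C (d + 1) f) {x y : Vec n} (h : (x, y) ∈ C)
    (k : Fin n) : ∑ j, y j * _root_.dY j (_root_.dY k f) x y = d * _root_.dY k f x y :=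
  PosHomogOn.euler hC (hf.dY hC k) (hd.dY hC hf k) h

lemma smoothOnTangent_mul_coord (hP : SmoothOnTangent C P) (i : Fin n) :
    SmoothOnTangent C (fun x y => P x y * y i) := hP.mul (.coord i)

lemma dX_mul_coord (hC : IsOpen C) (hP : SmoothOnTangent C P) {x y : Vec n} (h : (x, y) ∈ C)
    (i k : Fin n) : dX k (fun x y => P x y * y i) x y = dX k P x y * y i := by
  rw [(isDerivation_dX hC k).mul hP (.coord i) h, dX_coord]
  ring

lemma dY_mul_coord (hC : IsOpen C) (hP : SmoothOnTangent C P) {x y : Vec n} (h : (x, y) ∈ C)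
    (i k : Fin n) : dY k (fun x y => P x y * y i) x y =
      dY k P x y * y i + (if i = k then 1 else 0) * P x y := by
  rw [(isDerivation_dY hC k).mul hP (.coord i) h, dY_coord]
  ring

lemma dX_dY_mul_coord (hC : IsOpen C) (hP : SmoothOnTangent C P) {x y : Vec n} (h : (x, y) ∈ C)
    (i j k : Fin n) : dX j (dY k (fun x y => P x y * y i)) x y =
      dX j (dY k P) x y * y i + (if i = k then 1 else 0) * dX j P x y := by
  have hD := isDerivation_dX hC j
  rw [hD.congr (fun _ _ h' => dY_mul_coord hC hP h' i k) h,
    hD.add ((hP.dY hC k).mul (.coord i)) (hP.const_mul _) h, dX_mul_coord hC (hP.dY hC k) h,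
    hD.const_mul _ hP h]

lemma dY_dY_mul_coord (hC : IsOpen C) (hP : SmoothOnTangent C P) {x y : Vec n} (h : (x, y) ∈ C)
    (i j k : Fin n) : dY j (dY k (fun x y => P x y * y i)) x y =
      dY j (dY k P) x y * y i + (if i = j then 1 else 0) * dY k P x y
        + (if i = k then 1 else 0) * dY j P x y := by
  have hD := isDerivation_dY hC j
  rw [hD.congr (fun _ _ h' => dY_mul_coord hC hP h' i k) h,
    hD.add ((hP.dY hC k).mul (.coord i)) (hP.const_mul _) h, dY_mul_coord hC (hP.dY hC k) h,
    hD.const_mul _ hP h]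

lemma dY_sum_coord_dX (hC : IsOpen C) (hP : SmoothOnTangent C P) {x y : Vec n} (h : (x, y) ∈ C)
    (k : Fin n) : dY k (fun x y => ∑ j, y j * dX j P x y) x y =
      ∑ j, y j * dX j (dY k P) x y + dX k P x y := by
  have hD := isDerivation_dY hC k
  rw [hD.sum _ (fun j => (SmoothOnTangent.coord j).mul (hP.dX hC j)) h]
  have : ∀ j, dY k (fun x y => y j * dX j P x y) x y =
      y j * dX j (dY k P) x y + (if j = k then 1 else 0) * dX j P x y := by
    intro j
    rw [hD.mul (.coord j) (hP.dX hC j) h, dY_coord, dX_dY_comm hC hP h]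
    ring
  simp [this, Finset.sum_add_distrib]

/-- The Riemann curvature of the spray `P yⁱ`, when `Ξ = P² - yʲ ∂P/∂xʲ` satisfies
`∂P/∂xᵏ - P ∂P/∂yᵏ = -½ ∂Ξ/∂yᵏ`. -/
lemma riemannCurv_mul_coord (hC : IsOpen C) (hP : SmoothOnTangent C P) (hP1 : PosHomogOn C 1 P)
    (hΞ : SmoothOnTangent C Ξ) (hΞ2 : PosHomogOn C 2 Ξ)
    (hPΞ : ∀ x y, (x, y) ∈ C → ∀ k, dX k P x y = P x y * dY k P x y - dY k Ξ x y / 2)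
    {x y : Vec n} (h : (x, y) ∈ C) (i k : Fin n) :
    riemannCurv (fun i x y => P x y * y i) i k x y =
      Ξ x y * (if i = k then 1 else 0) - dY k Ξ x y / 2 * y i := by
  -- Contracting `hPΞ` with `yᵏ` recovers `Ξ = P² - yʲ P_{xʲ}`; its `yᵏ`-derivative is `hS'`.
  have hS : ∀ x y, (x, y) ∈ C → ∑ j, y j * dX j P x y = P x y * P x y - Ξ x y := by
    intro x y h
    have e1 := hP1.euler hC hP h
    have e2 := hΞ2.euler hC hΞ h
    calc ∑ j, y j * dX j P x y
        = P x y * ∑ j, y j * dY j P x y - (∑ j, y j * dY j Ξ x y) / 2 := by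
          rw [Finset.mul_sum, Finset.sum_div, ← Finset.sum_sub_distrib]
          exact Finset.sum_congr rfl fun j _ => by rw [hPΞ x y h]; ring
      _ = _ := by rw [e1, e2]; push_cast; ring
  have hS' : ∑ j, y j * dX j (dY k P) x y = 2 * P x y * dY k P x y - dY k Ξ x y - dX k P x y := by
    have hD := isDerivation_dY hC k
    have e := dY_sum_coord_dX hC hP h k
    rw [hD.congr hS h, hD.sub (hP.mul hP) hΞ h, hD.mul hP hP h] at e
    linarith
  have e1 : ∑ j, y j * dY j P x y = P x y := by simpa using hP1.euler hC hP h
  have e2 : ∑ j, y j * dY j (dY k P) x y = 0 := by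
    simpa using PosHomogOn.euler_dY (d := 0) hC hP hP1 h k
  have s1 : ∑ j, y j * dX j (dY k (fun x y => P x y * y i)) x y =
      (∑ j, y j * dX j (dY k P) x y) * y i
        + (if i = k then 1 else 0) * ∑ j, y j * dX j P x y := by
    rw [Finset.sum_mul, Finset.mul_sum, ← Finset.sum_add_distrib]
    exact Finset.sum_congr rfl fun j _ => by rw [dX_dY_mul_coord hC hP h]; ring
  have s2 : ∑ j, P x y * y j * dY j (dY k (fun x y => P x y * y i)) x y =
      P x y * y i * (∑ j, y j * dY j (dY k P) x y) + P x y * dY k P x y * y i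
        + (if i = k then 1 else 0) * P x y * ∑ j, y j * dY j P x y := by
    have : P x y * dY k P x y * y i =
        ∑ j, (if i = j then 1 else 0) * (P x y * dY k P x y * y j) := by simp
    rw [this, Finset.mul_sum, Finset.mul_sum, ← Finset.sum_add_distrib, ← Finset.sum_add_distrib]
    exact Finset.sum_congr rfl fun j _ => by rw [dY_dY_mul_coord hC hP h]; ring
  have s3 : ∑ j, dY j (fun x y => P x y * y i) x y * dY k (fun x y => P x y * y j) x y =
      dY k P x y * y i * (∑ j, y j * dY j P x y) + P x y * dY k P x y * y i
        + P x y * dY k P x y * y i + (if i = k then 1 else 0) * (P x y * P x y) := by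
    have t1 : P x y * dY k P x y * y i =
        ∑ j, (if j = k then 1 else 0) * (P x y * dY j P x y * y i) := by simp
    have t2 : P x y * dY k P x y * y i =
        ∑ j, (if i = j then 1 else 0) * (P x y * dY k P x y * y j) := by simp
    have t3 : (if i = k then 1 else 0) * (P x y * P x y) =
        ∑ j, (if i = j then 1 else 0) * ((if j = k then 1 else 0) * (P x y * P x y)) := by simp
    rw [t3]
    nth_rw 1 [t1]
    rw [t2, Finset.mul_sum, ← Finset.sum_add_distrib, ← Finset.sum_add_distrib,
      ← Finset.sum_add_distrib]
    exact Finset.sum_congr rfl fun j _ => by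
      rw [dY_mul_coord hC hP h, dY_mul_coord hC hP h]; ring
  simp only [riemannCurv]
  rw [s1, s2, s3, dX_mul_coord hC hP h, e1, e2, hS', hS x y h, hPΞ x y h]
  ring

/-- For the spray `P yⁱ`, the horizontal derivative of `½ ∂Ξ/∂yⁱ` is the vertical derivative of
the horizontal derivative of `½ Ξ`. -/
lemma horizDeriv_half_dY (hC : IsOpen C) (hP : SmoothOnTangent C P)
    (hΞ : SmoothOnTangent C Ξ) (hΞ2 : PosHomogOn C 2 Ξ) {x y : Vec n} (h : (x, y) ∈ C)
    (i k : Fin n) :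
    horizDeriv (fun i x y => P x y * y i) (fun i x y => dY i Ξ x y / 2) i k x y =
      dY i (fun x y => dX k Ξ x y - 2 * (dY k P x y * Ξ x y) - P x y * dY k Ξ x y) x y / 2 := by
  have hD := isDerivation_dY hC i
  have sk := hΞ.dY hC k
  have half : ∀ i, (fun x y => dY i Ξ x y / 2) = fun x y => (1 / 2) * dY i Ξ x y := by
    intro i; ext; ring
  have t0 : dX k (fun x y => dY i Ξ x y / 2) x y = dX k (dY i Ξ) x y / 2 := by
    rw [half, (isDerivation_dX hC k).const_mul _ (hΞ.dY hC i) h]; ring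
  have t1 : ∀ r, dY r (fun x y => dY i Ξ x y / 2) x y = dY r (dY i Ξ) x y / 2 := by
    intro r
    rw [half, (isDerivation_dY hC r).const_mul _ (hΞ.dY hC i) h]; ring
  have e1 : ∑ j, y j * dY j Ξ x y = 2 * Ξ x y := by simpa using hΞ2.euler hC hΞ h
  have e2 : ∑ j, y j * dY j (dY i Ξ) x y = dY i Ξ x y := by
    simpa using PosHomogOn.euler_dY (d := 1) hC hΞ hΞ2 h i
  have s1 : ∑ r, dY k (fun x y => P x y * y r) x y * dY r (fun x y => dY i Ξ x y / 2) x y =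
      dY k P x y / 2 * (∑ r, y r * dY r (dY i Ξ) x y) + P x y * dY k (dY i Ξ) x y / 2 := by
    have : P x y * dY k (dY i Ξ) x y / 2 =
        ∑ r, (if r = k then 1 else 0) * (P x y * dY r (dY i Ξ) x y / 2) := by simp
    rw [this, Finset.mul_sum, ← Finset.sum_add_distrib]
    exact Finset.sum_congr rfl fun j _ => by rw [dY_mul_coord hC hP h, t1]; ring
  have s2 : ∑ r, dY r Ξ x y / 2 * dY k (dY i (fun x y => P x y * y r)) x y =
      dY k (dY i P) x y / 2 * (∑ r, y r * dY r Ξ x y) + dY k Ξ x y / 2 * dY i P x y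
        + dY i Ξ x y / 2 * dY k P x y := by
    have u1 : dY k Ξ x y / 2 * dY i P x y =
        ∑ r, (if r = k then 1 else 0) * (dY r Ξ x y / 2 * dY i P x y) := by simp
    have u2 : dY i Ξ x y / 2 * dY k P x y =
        ∑ r, (if r = i then 1 else 0) * (dY r Ξ x y / 2 * dY k P x y) := by simp
    rw [u1, u2, Finset.mul_sum, ← Finset.sum_add_distrib, ← Finset.sum_add_distrib]
    exact Finset.sum_congr rfl fun j _ => by rw [dY_dY_mul_coord hC hP h]; ring
  simp only [horizDeriv]
  rw [s1, s2, t0, e1, e2,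
    hD.sub ((hΞ.dX hC k).sub (((hP.dY hC k).mul hΞ).const_mul 2)) (hP.mul sk) h,
    hD.sub (hΞ.dX hC k) (((hP.dY hC k).mul hΞ).const_mul 2) h,
    hD.const_mul 2 ((hP.dY hC k).mul hΞ) h, hD.mul (hP.dY hC k) hΞ h, hD.mul hP sk h,
    dX_dY_comm hC hΞ h, dY_comm hC hP h k i, dY_comm hC hΞ h k i]
  ring

lemma fundTensor_apply (hC : IsOpen C) (hL : SmoothOnTangent C L) {x y : Vec n}
    (h : (x, y) ∈ C) (i j : Fin n) : fundTensor L x y i j = dY j (dY i L) x y / 2 := by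
  have half : (fun x y => L x y / 2) = fun x y => (1 / 2) * L x y := by ext; ring
  simp only [fundTensor, Matrix.of_apply]
  rw [half, (isDerivation_dY hC j).congr
    (fun _ _ h' => (isDerivation_dY hC i).const_mul (1 / 2) hL h') h,
    (isDerivation_dY hC j).const_mul _ (hL.dY hC i) h]
  ring

/-- Lowering the index: by Euler's relation `g_{lj} yʲ = L_{yˡ}/2`, and `g` is invertible, so the
spray equation can be tested without the inverse matrix. -/
lemma mul_coord_eq_finslerSpray_iff (hC : IsOpen C) (hL : IsFinslerMetric C L) {x y : Vec n}
    (h : (x, y) ∈ C) : (∀ i, P x y * y i = finslerSpray L i x y) ↔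
      ∀ l, 2 * P x y * dY l L x y = ∑ k, y k * dX k (dY l L) x y - dX l L x y := by
  set V : Vec n := fun l => ∑ k, dX k (dY l L) x y * y k - dX l L x y with hV
  have hdet : IsUnit (fundTensor L x y).det := (hL.nondegenerate x y h).isUnit
  have e : (fundTensor L x y).mulVec (P x y • y) = fun l => P x y * dY l L x y / 2 := by
    ext l
    have e2 : ∑ j, y j * dY j (dY l L) x y = dY l L x y := by
      simpa using PosHomogOn.euler_dY (d := 1) hC hL.smooth hL.homog h l
    rw [← e2, Finset.mul_sum, Finset.sum_div]
    simp only [Matrix.mulVec, dotProduct, Pi.smul_apply, smul_eq_mul]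
    exact Finset.sum_congr rfl fun j _ => by rw [fundTensor_apply hC hL.smooth h]; ring
  have e' : (∀ i, P x y * y i = finslerSpray L i x y) ↔
      P x y • y = (fundTensor L x y)⁻¹.mulVec ((1 / 4 : ℝ) • V) := by
    rw [funext_iff]
    refine forall_congr' fun i => ?_
    rw [Matrix.mulVec_smul]
    simp [finslerSpray, Matrix.mulVec, dotProduct, hV]
  rw [e']
  have : P x y • y = (fundTensor L x y)⁻¹.mulVec ((1 / 4 : ℝ) • V) ↔
      (fundTensor L x y).mulVec (P x y • y) = (1 / 4 : ℝ) • V := by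
    constructor
    · intro hy
      rw [hy, Matrix.mulVec_mulVec, Matrix.mul_nonsing_inv _ hdet, Matrix.one_mulVec]
    · intro hy
      rw [← hy, Matrix.mulVec_mulVec, Matrix.nonsing_inv_mul _ hdet, Matrix.one_mulVec]
  rw [this, e, funext_iff]
  refine forall_congr' fun l => ?_
  have hVl : V l = ∑ k, y k * dX k (dY l L) x y - dX l L x y := by simp [hV, mul_comm]
  rw [← hVl]
  simp only [Pi.smul_apply, smul_eq_mul]
  constructor <;> intro hh <;> linarith

lemma sum_coord_dX_dY (hC : IsOpen C) (hP : SmoothOnTangent C P) (hL : SmoothOnTangent C L)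
    (hS : ∀ x y, (x, y) ∈ C → ∑ k, y k * dX k L x y = 4 * (P x y * L x y))
    {x y : Vec n} (h : (x, y) ∈ C) (l : Fin n) :
    ∑ k, y k * dX k (dY l L) x y =
      4 * (dY l P x y * L x y + P x y * dY l L x y) - dX l L x y := by
  have hD := isDerivation_dY hC l
  have e := dY_sum_coord_dX hC hL h l
  rw [hD.congr hS h, hD.const_mul _ (hP.mul hL) h, hD.mul hP hL h] at e
  linarith

/-- A Finsler metric `L` with `∂L/∂xᵏ = 2 L ∂P/∂yᵏ + P ∂L/∂yᵏ` induces the spray `P yⁱ`. -/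
lemma induces_mul_coord (hC : IsOpen C) (hP : SmoothOnTangent C P) (hP1 : PosHomogOn C 1 P)
    (hL : IsFinslerMetric C L)
    (hLP : ∀ x y, (x, y) ∈ C → ∀ k,
      dX k L x y = 2 * (dY k P x y * L x y) + P x y * dY k L x y) :
    Induces C L (fun i x y => P x y * y i) := by
  refine ⟨hL, fun x y h => (mul_coord_eq_finslerSpray_iff hC hL h).2 fun l => ?_⟩
  rw [sum_coord_dX_dY hC hP hL.smooth _ h, hLP x y h]
  · ring
  · intro x y h
    have e1 : ∑ j, y j * dY j L x y = 2 * L x y := by simpa using hL.homog.euler hC hL.smooth h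
    have e2 : ∑ j, y j * dY j P x y = P x y := by simpa using hP1.euler hC hP h
    calc ∑ k, y k * dX k L x y
        = 2 * L x y * (∑ j, y j * dY j P x y) + P x y * ∑ j, y j * dY j L x y := by
          rw [Finset.mul_sum, Finset.mul_sum, ← Finset.sum_add_distrib]
          exact Finset.sum_congr rfl fun j _ => by rw [hLP x y h]; ring
      _ = _ := by rw [e1, e2]; ring

/-- If `L` induces the spray `P yⁱ`, then `L` is horizontally constant. -/
lemma Induces.dX_eq (hC : IsOpen C) (hP : SmoothOnTangent C P)
    (hL : Induces C L (fun i x y => P x y * y i)) {x y : Vec n} (h : (x, y) ∈ C) (k : Fin n) :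
    dX k L x y = 2 * (dY k P x y * L x y) + P x y * dY k L x y := by
  obtain ⟨hL, hG⟩ := hL
  have hV := fun x y h => (mul_coord_eq_finslerSpray_iff (P := P) hC hL h).1 (hG x y h)
  -- Contract the lowered spray equation with `yˡ`: the double sum contributes twice `yᵏ L_{xᵏ}` by
  -- homogeneity of `L_{xᵏ}`. Differentiating the result in `y` and substituting back then isolates
  -- `L_{xᵏ}`.
  have hS : ∀ x y, (x, y) ∈ C → ∑ k, y k * dX k L x y = 4 * (P x y * L x y) := by
    intro x y h
    have e1 : ∀ x y, (x, y) ∈ C → ∑ j, y j * dY j L x y = 2 * L x y := by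
      intro x y h; simpa using hL.homog.euler hC hL.smooth h
    have e3 : ∀ k, ∑ l, y l * dX k (dY l L) x y = 2 * dX k L x y := by
      intro k
      have hD := isDerivation_dX hC k
      have hs := fun l => (SmoothOnTangent.coord (C := C) l).mul (hL.smooth.dY hC l)
      have e := hD.congr e1 h
      rw [hD.sum _ hs h, hD.const_mul _ hL.smooth h] at e
      rw [← e]
      refine Finset.sum_congr rfl fun l _ => ?_
      rw [hD.mul (.coord l) (hL.smooth.dY hC l) h, dX_coord]
      ring
    have e4 : ∑ l, y l * (2 * P x y * dY l L x y) =
        ∑ l, y l * ∑ k, y k * dX k (dY l L) x y - ∑ l, y l * dX l L x y := by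
      rw [← Finset.sum_sub_distrib]
      exact Finset.sum_congr rfl fun l _ => by rw [hV x y h l]; ring
    have e5 : ∑ l, y l * ∑ k, y k * dX k (dY l L) x y = 2 * ∑ k, y k * dX k L x y := by
      simp only [Finset.mul_sum]
      rw [Finset.sum_comm]
      refine Finset.sum_congr rfl fun k _ => ?_
      calc ∑ l, y l * (y k * dX k (dY l L) x y) = y k * ∑ l, y l * dX k (dY l L) x y := by
            rw [Finset.mul_sum]; exact Finset.sum_congr rfl fun l _ => by ring
        _ = _ := by rw [e3]; ring
    have e6 : ∑ l, y l * (2 * P x y * dY l L x y) = 2 * P x y * ∑ l, y l * dY l L x y := by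
      rw [Finset.mul_sum]; exact Finset.sum_congr rfl fun l _ => by ring
    rw [e6, e5, e1 x y h] at e4
    linarith
  have := hV x y h k
  rw [sum_coord_dX_dY hC hP hL.smooth hS h] at this
  linarith

end ProjectivelyFlat

/-! ### Obstruction to metrizability -/

section Metrizability

variable {C : Set (Vec n × Vec n)} {P L Ξ A a b : Vec n → Vec n → ℝ}

lemma PosHomogOn.mono {d : ℕ} {C' : Set (Vec n × Vec n)} {f : Vec n → Vec n → ℝ}
    (hf : PosHomogOn C d f) (h : C' ⊆ C) : PosHomogOn C' d f :=
  fun x y hxy => hf x y (h hxy)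

/-- The integrability condition of the system for `L`: expand `L_{xʲxᵏ} = L_{xᵏxʲ}` with the
first-order equations, and only the terms in `Ξ` survive. -/
lemma dY_mul_dY_symm (hC : IsOpen C) (hP : SmoothOnTangent C P)
    (hΞ : SmoothOnTangent C Ξ) (hL : SmoothOnTangent C L)
    (hPΞ : ∀ x y, (x, y) ∈ C → ∀ k, dX k P x y = P x y * dY k P x y - (1 / 2) * dY k Ξ x y)
    (hLP : ∀ x y, (x, y) ∈ C → ∀ k,
      dX k L x y = 2 * (dY k P x y * L x y) + P x y * dY k L x y)
    {x y : Vec n} (h : (x, y) ∈ C) (j k : Fin n) :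
    dY j Ξ x y * dY k L x y = dY k Ξ x y * dY j L x y := by
  have second : ∀ j k, dX j (dX k L) x y =
      2 * (dX j (dY k P) x y * L x y + dY k P x y * dX j L x y)
        + (dX j P x y * dY k L x y + P x y * dX j (dY k L) x y) := by
    intro j k
    have hD := isDerivation_dX hC j
    rw [hD.congr (fun x y h => hLP x y h k) h,
      hD.add (((hP.dY hC k).mul hL).const_mul 2) (hP.mul (hL.dY hC k)) h,
      hD.const_mul 2 ((hP.dY hC k).mul hL) h, hD.mul (hP.dY hC k) hL h, hD.mul hP (hL.dY hC k) h]
  have mixedP : ∀ j k, dX j (dY k P) x y =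
      dY k P x y * dY j P x y + P x y * dY k (dY j P) x y - (1 / 2) * dY k (dY j Ξ) x y := by
    intro j k
    have hD := isDerivation_dY hC k
    rw [dX_dY_comm hC hP h, hD.congr (fun x y h => hPΞ x y h j) h,
      hD.sub (hP.mul (hP.dY hC j)) ((hΞ.dY hC j).const_mul _) h, hD.mul hP (hP.dY hC j) h,
      hD.const_mul _ (hΞ.dY hC j) h]
  have mixedL : ∀ j k, dX j (dY k L) x y =
      2 * (dY k (dY j P) x y * L x y + dY j P x y * dY k L x y)
        + (dY k P x y * dY j L x y + P x y * dY k (dY j L) x y) := by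
    intro j k
    have hD := isDerivation_dY hC k
    rw [dX_dY_comm hC hL h, hD.congr (fun x y h => hLP x y h j) h,
      hD.add (((hP.dY hC j).mul hL).const_mul 2) (hP.mul (hL.dY hC j)) h,
      hD.const_mul 2 ((hP.dY hC j).mul hL) h, hD.mul (hP.dY hC j) hL h, hD.mul hP (hL.dY hC j) h]
  have e := dX_comm hC hL h j k
  rw [second j k, second k j, mixedP j k, mixedP k j, mixedL j k, mixedL k j, hLP x y h,
    hLP x y h, hPΞ x y h, hPΞ x y h, dY_comm hC hP h j k, dY_comm hC hΞ h j k,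
    dY_comm hC hL h j k] at e
  linear_combination (-2) * e

/-- If the horizontal derivative of `Ξ` is a non-zero multiple of `∂A/∂yᵏ` with `A` homogeneous of
degree three, then `A` vanishes wherever the horizontally constant Finsler metric `L` does not:
otherwise the fundamental tensor of `L` would have rank one. -/
lemma eq_zero_of_horizontally_constant (hn : 2 ≤ n) (hC : IsOpen C) (hP : SmoothOnTangent C P)
    (hΞ : SmoothOnTangent C Ξ) (hΞ2 : PosHomogOn C 2 Ξ) (hA : SmoothOnTangent C A)
    (hA3 : PosHomogOn C 3 A) {m : ℝ} (hm : m ≠ 0)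
    (hPΞ : ∀ x y, (x, y) ∈ C → ∀ k, dX k P x y = P x y * dY k P x y - (1 / 2) * dY k Ξ x y)
    (hΞA : ∀ x y, (x, y) ∈ C → ∀ k,
      dX k Ξ x y - 2 * (dY k P x y * Ξ x y) - P x y * dY k Ξ x y = m * dY k A x y)
    (hL : IsFinslerMetric C L)
    (hLP : ∀ x y, (x, y) ∈ C → ∀ k,
      dX k L x y = 2 * (dY k P x y * L x y) + P x y * dY k L x y)
    {x y : Vec n} (h : (x, y) ∈ C) (hLxy : L x y ≠ 0) : A x y = 0 := by
  have sL := hL.smooth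
  -- Where `L ≠ 0` this says that `Ξ / L` has zero `y`-gradient; it is the integrability condition
  -- contracted with `yʲ`.
  have vert : ∀ x y, (x, y) ∈ C → ∀ k, Ξ x y * dY k L x y = dY k Ξ x y * L x y := by
    intro x y h k
    have e1 : ∑ j, y j * dY j L x y = 2 * L x y := by simpa using hL.homog.euler hC sL h
    have e2 : ∑ j, y j * dY j Ξ x y = 2 * Ξ x y := by simpa using hΞ2.euler hC hΞ h
    have e3 : (∑ j, y j * dY j Ξ x y) * dY k L x y = dY k Ξ x y * ∑ j, y j * dY j L x y := by
      rw [Finset.sum_mul, Finset.mul_sum]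
      refine Finset.sum_congr rfl fun j _ => ?_
      linear_combination y j * dY_mul_dY_symm hC hP hΞ sL hPΞ hLP h j k
    rw [e1, e2] at e3
    linarith
  -- The `x`-gradient of `Ξ / L`, cleared of denominators; the vertical terms cancel by `vert`.
  have hor : ∀ x y, (x, y) ∈ C → ∀ k,
      m * (dY k A x y * L x y) = dX k Ξ x y * L x y - Ξ x y * dX k L x y := by
    intro x y h k
    linear_combination (-L x y) * hΞA x y h k + Ξ x y * hLP x y h k + P x y * vert x y h k
  -- Equality of the mixed partials of `Ξ / L`: compare the `yⁱ`-derivative of `hor` with the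
  -- `xᵏ`-derivative of `vert`. The outcome is that `A_{yᵏ} / L` has zero `y`-gradient.
  have rank : ∀ x y, (x, y) ∈ C → L x y ≠ 0 → ∀ i k,
      dY i (dY k A) x y * L x y = dY k A x y * dY i L x y := by
    intro x y h h0 i k
    have hD := isDerivation_dY hC i
    have hE := isDerivation_dX hC k
    have e1 := hD.congr (fun x y h => hor x y h k) h
    rw [hD.const_mul m ((hA.dY hC k).mul sL) h, hD.mul (hA.dY hC k) sL h,
      hD.sub ((hΞ.dX hC k).mul sL) (hΞ.mul (sL.dX hC k)) h, hD.mul (hΞ.dX hC k) sL h,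
      hD.mul hΞ (sL.dX hC k) h, ← dX_dY_comm hC hΞ h, ← dX_dY_comm hC sL h] at e1
    have e2 := hE.congr (fun x y h => vert x y h i) h
    rw [hE.mul hΞ (sL.dY hC i) h, hE.mul (hΞ.dY hC i) sL h] at e2
    have e3 := vert x y h i
    have e4 := hor x y h k
    refine mul_left_cancel₀ (mul_ne_zero hm h0) ?_
    linear_combination L x y * e1 - L x y * e2 - 2 * dY i L x y * e4 + 2 * dX k L x y * e3
  -- `contr` is differentiated again below, so it is needed on an open set, not just at the given
  -- point.
  set C' : Set (Vec n × Vec n) := C ∩ (fun p : Vec n × Vec n => L p.1 p.2) ⁻¹' {0}ᶜ with hC'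
  have hC'o : IsOpen C' := (ContDiffOn.continuousOn sL).isOpen_inter_preimage hC
    isOpen_compl_singleton
  have hsub : C' ⊆ C := Set.inter_subset_left
  have contr : ∀ x y, (x, y) ∈ C' → ∀ k,
      2 * (dY k A x y * L x y) = 3 * (A x y * dY k L x y) := by
    intro x y h k
    have e1 : ∑ j, y j * dY j A x y = 3 * A x y := by simpa using hA3.euler hC hA h.1
    have e2 : ∑ j, y j * dY j (dY k A) x y = 2 * dY k A x y := by
      simpa using PosHomogOn.euler_dY (d := 2) hC hA hA3 h.1 k
    have e3 : (∑ j, y j * dY j (dY k A) x y) * L x y = (∑ j, y j * dY j A x y) * dY k L x y := by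
      rw [Finset.sum_mul, Finset.sum_mul]
      refine Finset.sum_congr rfl fun j _ => ?_
      rw [dY_comm hC hA h.1]
      linear_combination y j * rank x y h.1 h.2 k j
    rw [e1, e2] at e3
    linarith
  by_contra hA0
  have hxy : (x, y) ∈ C' := ⟨h, hLxy⟩
  refine hL.nondegenerate x y h ?_
  -- Differentiate `contr` and eliminate `A_{yⁱyᵏ} L` by `rank`, using that `A_{yᵏ} L_{yⁱ}` is
  -- symmetric in `i` and `k`.
  have hess : ∀ i k, 3 * A x y * dY i (dY k L) x y = dY k A x y * dY i L x y := by
    intro i k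
    have hD := isDerivation_dY hC'o i
    have mA := hA.mono hsub
    have mL := sL.mono hsub
    have e1 := hD.congr (fun x y h => contr x y h k) hxy
    rw [hD.const_mul 2 ((mA.dY hC'o k).mul mL) hxy, hD.const_mul 3 (mA.mul (mL.dY hC'o k)) hxy,
      hD.mul (mA.dY hC'o k) mL hxy, hD.mul mA (mL.dY hC'o k) hxy] at e1
    have e2 := rank x y h hLxy i k
    have e3 := rank x y h hLxy k i
    rw [dY_comm hC hA h] at e3
    linear_combination -e1 - e2 + 3 * e3
  have : fundTensor L x y =
      Matrix.vecMulVec (fun i => dY i A x y / (6 * A x y)) (fun j => dY j L x y) := by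
    ext i j
    rw [fundTensor_apply hC sL h, Matrix.vecMulVec_apply]
    field_simp
    linear_combination 2 * hess j i
  rw [this]
  have : Nontrivial (Fin n) := Fin.nontrivial_iff_two_le.2 hn
  exact Matrix.det_vecMulVec _ _

/-- The sign of `L` is unrestricted and zeros are allowed, but vanishing on the whole open set would
make the fundamental tensor zero. -/
lemma IsFinslerMetric.exists_ne_zero (hn : 2 ≤ n) (hC : IsOpen C) (hne : C.Nonempty)
    (hL : IsFinslerMetric C L) : ∃ x y, (x, y) ∈ C ∧ L x y ≠ 0 := by
  by_contra! h0
  obtain ⟨⟨x, y⟩, h⟩ := hne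
  refine hL.nondegenerate x y h ?_
  have h1 : ∀ i x y, (x, y) ∈ C → dY i L x y = 0 := by
    intro i x y h
    rw [(isDerivation_dY hC i).congr h0 h, (isDerivation_dY hC i).zero h]
  have : fundTensor L x y = 0 := by
    ext i j
    rw [fundTensor_apply hC hL.smooth h, (isDerivation_dY hC j).congr (h1 i) h,
      (isDerivation_dY hC j).zero h]
    simp
  have : Nonempty (Fin n) := Fin.pos_iff_nonempty.1 (by omega)
  simp [*]

/-- Two positive functions with `∂a/∂xᵏ = a ∂a/∂yᵏ` and `∂b/∂xᵏ = -b ∂b/∂yᵏ` satisfy no relation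
`a b² + κ b³ = 0` on a non-empty open set. -/
lemma not_forall_cubic_eq_zero (hC : IsOpen C) (hne : C.Nonempty)
    (hb : SmoothOnTangent C b)
    (hb1 : PosHomogOn C 1 b) (ha0 : ∀ x y, (x, y) ∈ C → 0 < a x y)
    (hb0 : ∀ x y, (x, y) ∈ C → 0 < b x y)
    (hax : ∀ x y, (x, y) ∈ C → ∀ k, dX k a x y = a x y * dY k a x y)
    (hbx : ∀ x y, (x, y) ∈ C → ∀ k, dX k b x y = -(b x y * dY k b x y)) (κ : ℝ) :
    ¬ ∀ x y, (x, y) ∈ C → a x y * (b x y * b x y) + κ * (b x y * (b x y * b x y)) = 0 := by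
  intro hA
  have hab : ∀ x y, (x, y) ∈ C → a x y = -κ * b x y := by
    intro x y h
    have := hb0 x y h
    refine mul_right_cancel₀ (mul_pos this this).ne' ?_
    linear_combination hA x y h
  obtain ⟨⟨x, y⟩, h⟩ := hne
  -- Substituting `a = -κ b` into the equation for `a` and using that for `b` gives `κ = κ²` after
  -- contraction with `y`, while positivity of `a` and `b` requires `κ < 0`.
  have e : ∀ k, κ * (b x y * dY k b x y) = κ * κ * (b x y * dY k b x y) := by
    intro k
    have e1 := hax x y h k
    rw [(isDerivation_dX hC k).congr hab h, (isDerivation_dY hC k).congr hab h,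
      (isDerivation_dX hC k).const_mul _ hb h, (isDerivation_dY hC k).const_mul _ hb h,
      hbx x y h, hab x y h] at e1
    linear_combination e1
  have e1 : ∑ j, y j * dY j b x y = b x y := by simpa using hb1.euler hC hb h
  have e2 : κ * b x y * (∑ j, y j * dY j b x y) = κ * κ * b x y * ∑ j, y j * dY j b x y := by
    rw [Finset.mul_sum, Finset.mul_sum]
    exact Finset.sum_congr rfl fun j _ => by linear_combination y j * e j
  rw [e1] at e2
  have hb' := hb0 x y h
  have hκ : κ < 0 := by
    have := ha0 x y h
    rw [hab x y h] at this
    by_contra! hκ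
    nlinarith [mul_nonneg hκ hb'.le]
  have : κ = κ * κ := mul_right_cancel₀ (mul_pos hb' hb').ne' (by linear_combination e2)
  nlinarith

end Metrizability

/-! ### Convexity in `y` and the kernel of the Hessian -/

section Hessian

variable {C : Set (Vec n × Vec n)} {f : Vec n → Vec n → ℝ}

lemma PosHomogOn.dX {d : ℕ} (hC : IsOpen C) (hf : SmoothOnTangent C f) (hd : PosHomogOn C d f)
    (k : Fin n) : PosHomogOn C d (dX k f) := by
  intro x y h t ht
  have h1 : (fun z => f z (t • y)) =ᶠ[nhds x] fun z => t ^ d • f z y := by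
    have hc : Continuous fun z : Vec n => (z, y) := by fun_prop
    filter_upwards [(hC.preimage hc).mem_nhds h] with z hz using hd z y hz t ht
  have h2 : fderiv ℝ (fun z => t ^ d • f z y) x = t ^ d • fderiv ℝ (fun z => f z y) x :=
    fderiv_fun_const_smul (hf.differentiableAt_fst hC h) _
  simp only [_root_.dX]
  rw [h1.fderiv_eq, h2]
  simp

/-- A function `φ` of one variable with `φ t + φ (-t) ≥ 2 φ 0` for small `t` has non-negative second
derivative at `0`. -/
lemma second_deriv_nonneg_of_midpoint {φ φ' : ℝ → ℝ} {φ'' : ℝ}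
    (h1 : ∀ᶠ t in nhds 0, HasDerivAt φ (φ' t) t) (h2 : HasDerivAt φ' φ'' 0)
    (hmid : ∀ᶠ t in nhds 0, 2 * φ 0 ≤ φ t + φ (-t)) : 0 ≤ φ'' := by
  by_contra! hneg
  have hn : Filter.Tendsto (fun t : ℝ => -t) (nhds 0) (nhds 0) := by
    simpa using (continuous_neg (G := ℝ)).tendsto 0
  set ψ : ℝ → ℝ := fun t => φ t + φ (-t) with hψ
  have d1 : ∀ᶠ t in nhds 0, HasDerivAt ψ (φ' t - φ' (-t)) t := by
    filter_upwards [h1, hn.eventually h1] with t ht ht'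
    have : HasDerivAt ψ (φ' t + φ' (-t) * -1) t := ht.add (ht'.comp t (hasDerivAt_neg t))
    exact this.congr_deriv (by ring)
  have d2 : deriv ψ =ᶠ[nhds 0] fun t => φ' t - φ' (-t) := by
    filter_upwards [d1] with t ht using ht.deriv
  have d3 : HasDerivAt (fun t => φ' t - φ' (-t)) (2 * φ'') 0 := by
    have h2' : HasDerivAt φ' φ'' (-0) := by simpa using h2
    have : HasDerivAt (fun t => φ' t - φ' (-t)) (φ'' - φ'' * -1) 0 :=
      h2.sub (h2'.comp 0 (hasDerivAt_neg (0 : ℝ)))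
    exact this.congr_deriv (by ring)
  have d4 : deriv (deriv ψ) 0 = 2 * φ'' := by rw [d2.deriv_eq, d3.deriv]
  -- A negative second derivative makes `0` a local maximum of the even function `ψ`; the midpoint
  -- inequality makes it a local minimum too, so `ψ` is locally constant and its second derivative
  -- is zero.
  have hmax := isLocalMax_of_deriv_deriv_neg (f := ψ) (x₀ := 0) (by rw [d4]; linarith)
    (by rw [d1.self_of_nhds.deriv]; simp) d1.self_of_nhds.continuousAt
  have hconst : ψ =ᶠ[nhds 0] fun _ => ψ 0 := by
    filter_upwards [hmax, hmid] with t ht ht'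
    refine le_antisymm ht ?_
    simp only [hψ, neg_zero]
    linarith
  have hz : deriv ψ =ᶠ[nhds 0] fun _ => 0 := by
    have := hconst.deriv
    simpa using this
  rw [hz.deriv_eq] at d4
  simp at d4
  linarith

/-- The Hessian in `y` of a subadditive function of degree one is positive semidefinite. -/
lemma hessian_nonneg_of_subadditive {Ω : Set (Vec n)} (hC : IsOpen (slitTangent Ω))
    (hf : SmoothOnTangent (slitTangent Ω) f) (hf1 : PosHomogOn (slitTangent Ω) 1 f)
    {x : Vec n} (hx : x ∈ Ω)
    (hsub : ∀ y z, y ≠ 0 → z ≠ 0 → y + z ≠ 0 → f x (y + z) ≤ f x y + f x z)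
    {y : Vec n} (hy : y ≠ 0) (v : Vec n) : 0 ≤ ∑ i, ∑ j, v i * v j * dY j (dY i f) x y := by
  have hline : ∀ t : ℝ, HasDerivAt (fun t : ℝ => y + t • v) v t := fun t => by
    simpa using ((hasDerivAt_id t).smul_const v).const_add y
  have hcont : Continuous fun t : ℝ => y + t • v := by fun_prop
  have hev : ∀ᶠ t : ℝ in nhds 0, y + t • v ≠ 0 := by
    refine (hcont.isOpen_preimage _ isOpen_compl_singleton).mem_nhds ?_
    simpa using hy
  have along : ∀ g : Vec n → Vec n → ℝ, SmoothOnTangent (slitTangent Ω) g → ∀ t : ℝ,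
      y + t • v ≠ 0 →
      HasDerivAt (fun t : ℝ => g x (y + t • v)) (∑ k, v k * dY k g x (y + t • v)) t := by
    intro g hg t ht
    rw [← fderiv_snd_apply_eq_sum]
    exact (hg.differentiableAt_snd hC (x := x) (y := y + t • v)
      ⟨hx, ht⟩).hasFDerivAt.comp_hasDerivAt t (hline t)
  refine second_deriv_nonneg_of_midpoint (φ := fun t => f x (y + t • v))
    (φ' := fun t => ∑ k, v k * dY k f x (y + t • v)) ?_ ?_ ?_
  · filter_upwards [hev] with t ht using along f hf t ht
  · have : ∀ i ∈ Finset.univ, HasDerivAt (fun t : ℝ => v i * dY i f x (y + t • v))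
        (v i * ∑ j, v j * dY j (dY i f) x (y + (0 : ℝ) • v)) 0 := fun i _ =>
      (along (dY i f) (hf.dY hC i) 0 (by simpa using hy)).const_mul (v i)
    refine (HasDerivAt.fun_sum this).congr_deriv ?_
    refine Finset.sum_congr rfl fun i _ => ?_
    rw [Finset.mul_sum]
    exact Finset.sum_congr rfl fun j _ => by rw [zero_smul, add_zero]; ring
  · have hn : Filter.Tendsto (fun t : ℝ => -t) (nhds 0) (nhds 0) := by
      simpa using (continuous_neg (G := ℝ)).tendsto 0
    filter_upwards [hev, hn.eventually hev] with t ht ht'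
    have hs : (y + t • v) + (y + (-t) • v) = (2 : ℝ) • y := by
      rw [two_smul]; module
    have := hsub _ _ ht ht' (by rw [hs]; simpa using hy)
    rw [hs, hf1 x y ⟨hx, hy⟩ 2 two_pos] at this
    simpa using this

lemma fundTensor_sq_apply (hC : IsOpen C) (hf : SmoothOnTangent C f) {x y : Vec n}
    (h : (x, y) ∈ C) (i j : Fin n) : fundTensor (fun x y => f x y ^ 2) x y i j =
      f x y * dY j (dY i f) x y + dY i f x y * dY j f x y := by
  have hsq : (fun x y => f x y ^ 2) = fun x y => f x y * f x y := by ext; ring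
  have hD := isDerivation_dY hC j
  rw [hsq, fundTensor_apply hC (hf.mul hf) h,
    hD.congr (g := fun x y => 2 * (dY i f x y * f x y)) (fun x y h => by
      rw [(isDerivation_dY hC i).mul hf hf h]; ring) h,
    hD.const_mul 2 ((hf.dY hC i).mul hf) h, hD.mul (hf.dY hC i) hf h]
  ring

/-- The fundamental tensor of `f²` is `f Hess f + df ⊗ df`. With `f > 0` and `Hess f ≥ 0`, both
summands are non-negative and can be treated separately. -/
lemma dotProduct_fundTensor_sq (hC : IsOpen C) (hf : SmoothOnTangent C f) {x y : Vec n}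
    (h : (x, y) ∈ C) (v : Vec n) :
    v ⬝ᵥ (fundTensor (fun x y => f x y ^ 2) x y).mulVec v =
      f x y * (∑ i, ∑ j, v i * v j * dY j (dY i f) x y) + (∑ i, v i * dY i f x y) ^ 2 := by
  simp only [dotProduct, Matrix.mulVec, sq, Finset.mul_sum, Finset.sum_mul]
  rw [Finset.sum_comm (f := fun i j => v j * dY j f x y * (v i * dY i f x y)),
    ← Finset.sum_add_distrib]
  refine Finset.sum_congr rfl fun i _ => ?_
  rw [← Finset.sum_add_distrib]
  refine Finset.sum_congr rfl fun j _ => ?_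
  have := fundTensor_sq_apply hC hf h i j
  simp only [sq] at this
  rw [this]
  ring

/-- If `f²` is non-degenerate and the Hessian of `f` is positive semidefinite, then the Hessian
vanishes only in the radial direction. -/
lemma eq_smul_of_hessian_eq_zero (hC : IsOpen C) (hf : SmoothOnTangent C f)
    (hf1 : PosHomogOn C 1 f) {x y : Vec n} (h : (x, y) ∈ C) (hpos : 0 < f x y)
    (hdet : (fundTensor (fun x y => f x y ^ 2) x y).det ≠ 0)
    (hess : ∀ v : Vec n, 0 ≤ ∑ i, ∑ j, v i * v j * dY j (dY i f) x y) (v : Vec n)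
    (hv : ∑ i, ∑ j, v i * v j * dY j (dY i f) x y = 0) : ∃ t : ℝ, v = t • y := by
  set M := fundTensor (fun x y => f x y ^ 2) x y with hM
  have hpsd : M.PosSemidef := by
    refine Matrix.PosSemidef.of_dotProduct_mulVec_nonneg ?_ fun w => ?_
    · ext i j
      simp only [Matrix.conjTranspose_apply, star_trivial, hM]
      rw [fundTensor_sq_apply hC hf h, fundTensor_sq_apply hC hf h, dY_comm hC hf h]
      ring
    · simp only [star_trivial]
      rw [dotProduct_fundTensor_sq hC hf h]
      exact add_nonneg (mul_nonneg hpos.le (hess w)) (sq_nonneg _)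
  -- Since `df(y) = f`, this `t` places `v - t y` in the kernel of `df`; the radial correction
  -- leaves the Hessian form unchanged. Thus `v - t y` is null for the positive semidefinite `M`,
  -- hence in its kernel.
  set t := (∑ i, v i * dY i f x y) / f x y with ht
  refine ⟨t, ?_⟩
  have e1 : ∑ j, y j * dY j f x y = f x y := by simpa using hf1.euler hC hf h
  have e2 : ∀ k, ∑ j, y j * dY j (dY k f) x y = 0 := fun k => by
    simpa using PosHomogOn.euler_dY (d := 0) hC hf hf1 h k
  have l0 : ∑ i, (v - t • y) i * dY i f x y = 0 := by
    calc ∑ i, (v - t • y) i * dY i f x y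
        = ∑ i, v i * dY i f x y - t * ∑ i, y i * dY i f x y := by
          rw [Finset.mul_sum, ← Finset.sum_sub_distrib]
          exact Finset.sum_congr rfl fun i _ => by simp; ring
      _ = 0 := by rw [e1, ht]; field_simp; ring
  have q0 : ∑ i, ∑ j, (v - t • y) i * (v - t • y) j * dY j (dY i f) x y = 0 := by
    have r1 : ∀ i, ∑ j, (v - t • y) j * dY j (dY i f) x y = ∑ j, v j * dY j (dY i f) x y := by
      intro i
      calc ∑ j, (v - t • y) j * dY j (dY i f) x y
          = ∑ j, v j * dY j (dY i f) x y - t * ∑ j, y j * dY j (dY i f) x y := by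
            rw [Finset.mul_sum, ← Finset.sum_sub_distrib]
            exact Finset.sum_congr rfl fun i _ => by simp; ring
        _ = _ := by rw [e2]; ring
    have r2 : ∑ i, y i * ∑ j, v j * dY j (dY i f) x y = 0 := by
      simp only [Finset.mul_sum]
      rw [Finset.sum_comm]
      refine Finset.sum_eq_zero fun j _ => ?_
      have := e2 j
      calc ∑ i, y i * (v j * dY j (dY i f) x y) = v j * ∑ i, y i * dY i (dY j f) x y := by
            rw [Finset.mul_sum]
            exact Finset.sum_congr rfl fun i _ => by rw [dY_comm hC hf h i j]; ring
        _ = 0 := by rw [this, mul_zero]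
    calc ∑ i, ∑ j, (v - t • y) i * (v - t • y) j * dY j (dY i f) x y
        = ∑ i, (v - t • y) i * ∑ j, (v - t • y) j * dY j (dY i f) x y := by
          simp only [Finset.mul_sum, mul_assoc]
      _ = ∑ i, v i * ∑ j, v j * dY j (dY i f) x y
            - t * ∑ i, y i * ∑ j, v j * dY j (dY i f) x y := by
          rw [Finset.mul_sum, ← Finset.sum_sub_distrib]
          exact Finset.sum_congr rfl fun i _ => by rw [r1]; simp; ring
      _ = ∑ i, ∑ j, v i * v j * dY j (dY i f) x y := by
          rw [r2, mul_zero, sub_zero]; simp only [Finset.mul_sum, mul_assoc]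
      _ = 0 := hv
  have hq : star (v - t • y) ⬝ᵥ M.mulVec (v - t • y) = 0 := by
    rw [star_trivial, dotProduct_fundTensor_sq hC hf h, q0, l0]
    ring
  have hw := (hpsd.dotProduct_mulVec_zero_iff _).1 hq
  by_contra hne
  exact hdet (Matrix.exists_mulVec_eq_zero_iff.1 ⟨v - t • y, sub_ne_zero.2 hne, hw⟩)

end Hessian

/-! ### The Funk metric: first-order equations and subadditivity -/

section Funk

variable {Ω : Set (Vec n)} {F : Vec n → Vec n → ℝ}

lemma isOpen_slitTangent (hopen : IsOpen Ω) : IsOpen (slitTangent Ω) :=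
  (hopen.preimage continuous_fst).inter (isOpen_compl_singleton.preimage continuous_snd)

lemma neg_mem_slitTangent {x y : Vec n} (h : (x, y) ∈ slitTangent Ω) :
    (x, -y) ∈ slitTangent Ω := ⟨h.1, neg_ne_zero.2 h.2⟩

/-- If `s < t`, then `x + s y` lies strictly between an interior point and a point of the closure,
hence in the interior. So a ray leaves `Ω` only once. -/
lemma le_of_add_smul_mem_frontier (hopen : IsOpen Ω) (hconv : Convex ℝ Ω) {x y : Vec n}
    (hx : x ∈ Ω) {s t : ℝ} (hs : 0 < s) (hs' : x + s • y ∈ frontier Ω)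
    (ht : x + t • y ∈ closure Ω) : t ≤ s := by
  by_contra! hst
  have ht0 : 0 < t := hs.trans hst
  refine hs'.2 (hconv.openSegment_interior_closure_subset_interior
    (hopen.interior_eq.symm ▸ hx) ht ⟨1 - s / t, s / t, ?_, by positivity, by ring, ?_⟩)
  · rw [sub_pos, div_lt_one ht0]; exact hst
  · have : s / t * t = s := by field_simp
    rw [smul_add, smul_smul, this]
    module

namespace IsFunkMetric

lemma eq_inv_of_mem_frontier (hF : IsFunkMetric Ω F) (hopen : IsOpen Ω) (hconv : Convex ℝ Ω)
    {x y : Vec n} (h : (x, y) ∈ slitTangent Ω) {s : ℝ} (hs : 0 < s)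
    (hs' : x + s • y ∈ frontier Ω) : F x y = s⁻¹ := by
  have h1 := hF.mem_frontier x y h
  have h2 := inv_pos.2 (hF.pos x y h)
  have := le_antisymm
    (le_of_add_smul_mem_frontier hopen hconv h.1 hs hs' (frontier_subset_closure h1))
    (le_of_add_smul_mem_frontier hopen hconv h.1 h2 h1 (frontier_subset_closure hs'))
  rw [← this, inv_inv]

lemma smooth (hF : IsFunkMetric Ω F) : SmoothOnTangent (slitTangent Ω) F := by
  have h : SmoothOnTangent (slitTangent Ω) (fun x y => Real.sqrt (F x y ^ 2)) :=
    ContDiffOn.sqrt hF.finsler.smooth fun p hp => (pow_pos (hF.pos p.1 p.2 hp) 2).ne'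
  exact h.congr fun x y h => (Real.sqrt_sq (hF.pos x y h).le).symm

lemma homog (hF : IsFunkMetric Ω F) : PosHomogOn (slitTangent Ω) 1 F := by
  intro x y h t ht
  have h' : (x, t • y) ∈ slitTangent Ω := ⟨h.1, smul_ne_zero ht.ne' h.2⟩
  refine (pow_left_inj₀ (hF.pos _ _ h').le
    (mul_nonneg (by positivity) (hF.pos _ _ h).le) two_ne_zero).1 ?_
  have := hF.finsler.homog x y h t ht
  rw [this]
  ring

/-- Fix the exit point `p` and move the base point: `F(z, p - z) = 1` for all `z ∈ Ω`. -/
lemma dX_eq (hF : IsFunkMetric Ω F) (hopen : IsOpen Ω) (hconv : Convex ℝ Ω) {x y : Vec n}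
    (h : (x, y) ∈ slitTangent Ω) (k : Fin n) : dX k F x y = F x y * dY k F x y := by
  have hC := isOpen_slitTangent hopen
  have hpos := hF.pos x y h
  set s := (F x y)⁻¹ with hs
  have hs0 : 0 < s := inv_pos.2 hpos
  set p := x + s • y with hp
  have hpf : p ∈ frontier Ω := hF.mem_frontier x y h
  have hmem : ∀ z ∈ Ω, (z, p - z) ∈ slitTangent Ω := fun z hz => ⟨hz, fun h0 =>
    hpf.2 (by rw [hopen.interior_eq, sub_eq_zero.1 h0]; exact hz)⟩
  have hone : ∀ z ∈ Ω, F z (p - z) = 1 := fun z hz => by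
    simpa using hF.eq_inv_of_mem_frontier hopen hconv (hmem z hz) one_pos (by simpa using hpf)
  have hpx : p - x = s • y := by simp [hp]
  have hxs : (x, s • y) ∈ slitTangent Ω := hpx ▸ hmem x h.1
  have e : dX k F x (s • y) = dY k F x (s • y) := by
    have h1 : HasFDerivAt (fun z : Vec n => (z, p - z))
        ((ContinuousLinearMap.id ℝ (Vec n)).prod (-ContinuousLinearMap.id ℝ (Vec n))) x :=
      (hasFDerivAt_id x).prodMk ((hasFDerivAt_id x).const_sub p)
    have h2 := (hF.smooth.differentiableAt hC (hmem x h.1)).hasFDerivAt.comp x h1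
    have h3 : HasFDerivAt (fun z : Vec n => F z (p - z)) (0 : Vec n →L[ℝ] ℝ) x := by
      refine (hasFDerivAt_const (1 : ℝ) x).congr_of_eventuallyEq ?_
      filter_upwards [hopen.mem_nhds h.1] with z hz using hone z hz
    have h4 := congrArg (fun l => l (Pi.single k (1 : ℝ))) (h2.unique h3)
    rw [dX_eq_dirDeriv hC hF.smooth hxs, dY_eq_dirDeriv hC hF.smooth hxs, ← hpx]
    simp only [dirDeriv]
    rw [← sub_eq_zero, ← map_sub]
    simpa using h4
  -- The equality `F_{xᵏ} = F_{yᵏ}` holds at `(x, s y)`. Returning to `(x, y)` costs a factor `s =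
  -- 1/F` on the left only, since `F_{yᵏ}` has degree zero.
  rw [hF.homog.dX hC hF.smooth k x y h s hs0,
    PosHomogOn.dY (d := 0) hC hF.smooth hF.homog k x y h s hs0] at e
  rw [hs] at e
  field_simp at e
  linarith

lemma subadditive (hF : IsFunkMetric Ω F) (hopen : IsOpen Ω) (hconv : Convex ℝ Ω) {x : Vec n}
    (hx : x ∈ Ω) (y z : Vec n) (hy : y ≠ 0) (hz : z ≠ 0) (hyz : y + z ≠ 0) :
    F x (y + z) ≤ F x y + F x z := by
  have p1 := hF.pos x y ⟨hx, hy⟩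
  have p2 := hF.pos x z ⟨hx, hz⟩
  have p3 := hF.pos x (y + z) ⟨hx, hyz⟩
  refine (inv_le_inv₀ (add_pos p1 p2) p3).1 ?_
  refine le_of_add_smul_mem_frontier hopen hconv hx (inv_pos.2 p3)
    (hF.mem_frontier x (y + z) ⟨hx, hyz⟩) ?_
  -- Weighting the two exit points by `F(y)` and `F(z)`, normalised, gives `x + (y + z) / (F(y) +
  -- F(z))`, a point of the closure on the ray along `y + z`.
  have := hconv.closure (frontier_subset_closure (hF.mem_frontier x y ⟨hx, hy⟩))
    (frontier_subset_closure (hF.mem_frontier x z ⟨hx, hz⟩))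
    (div_nonneg p1.le (add_pos p1 p2).le) (div_nonneg p2.le (add_pos p1 p2).le) (by field_simp)
  convert this using 1
  have e1 : F x y / (F x y + F x z) * (F x y)⁻¹ = (F x y + F x z)⁻¹ := by field_simp
  have e2 : F x z / (F x y + F x z) * (F x z)⁻¹ = (F x y + F x z)⁻¹ := by field_simp
  have e3 : x = (F x y / (F x y + F x z)) • x + (F x z / (F x y + F x z)) • x := by
    rw [← add_smul, ← add_div, div_self (add_pos p1 p2).ne', one_smul]
  simp only [smul_add, smul_smul, e1, e2]
  nth_rw 1 [e3]
  abel

end IsFunkMetric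

/-- The reverse function `(x, y) ↦ f(x, -y)`. -/
def reverse (f : Vec n → Vec n → ℝ) (x y : Vec n) : ℝ := f x (-y)

lemma SmoothOnTangent.reverse {f : Vec n → Vec n → ℝ} (hf : SmoothOnTangent (slitTangent Ω) f) :
    SmoothOnTangent (slitTangent Ω) (reverse f) :=
  ContDiffOn.comp (g := fun p : Vec n × Vec n => f p.1 p.2) hf
    (f := fun p : Vec n × Vec n => (p.1, -p.2)) (by fun_prop)
    fun _ hp => neg_mem_slitTangent hp

lemma PosHomogOn.reverse {f : Vec n → Vec n → ℝ} {d : ℕ}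
    (hf : PosHomogOn (slitTangent Ω) d f) : PosHomogOn (slitTangent Ω) d (reverse f) := by
  intro x y h t ht
  have := hf x (-y) (neg_mem_slitTangent h) t ht
  simpa [_root_.reverse] using this

lemma dY_reverse (f : Vec n → Vec n → ℝ) (x y : Vec n) (k : Fin n) :
    dY k (reverse f) x y = -dY k f x (-y) := by
  simp only [dY, reverse]
  have := fderiv_comp_smul (𝕜 := ℝ) (f := fun w => f x w) (x := y) (-1)
  simp only [neg_smul, one_smul] at this
  rw [this]
  simp

lemma IsFunkMetric.dX_reverse (hF : IsFunkMetric Ω F) (hopen : IsOpen Ω) (hconv : Convex ℝ Ω)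
    {x y : Vec n} (h : (x, y) ∈ slitTangent Ω) (k : Fin n) :
    dX k (reverse F) x y = -(reverse F x y * dY k (reverse F) x y) := by
  rw [dY_reverse]
  have := hF.dX_eq hopen hconv (neg_mem_slitTangent h) k
  simp only [dX, reverse] at this ⊢
  rw [this]
  ring

end Funk

/-! ### Locality of the curvature, and uniqueness of `τ` -/

section Congruence

variable {C : Set (Vec n × Vec n)} {G H T S : Fin n → Vec n → Vec n → ℝ}

lemma riemannCurv_congr (hC : IsOpen C) (hGH : ∀ i x y, (x, y) ∈ C → G i x y = H i x y)
    {x y : Vec n} (h : (x, y) ∈ C) (i k : Fin n) :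
    riemannCurv G i k x y = riemannCurv H i k x y := by
  have e1 : ∀ j k x y, (x, y) ∈ C → dY k (G j) x y = dY k (H j) x y :=
    fun j k x y h => (isDerivation_dY hC k).congr (hGH j) h
  simp only [riemannCurv, (isDerivation_dX hC k).congr (hGH i) h, hGH _ x y h, e1 _ _ x y h,
    (isDerivation_dX hC _).congr (e1 _ _) h, (isDerivation_dY hC _).congr (e1 _ _) h]

lemma horizDeriv_congr (hC : IsOpen C) (hGH : ∀ i x y, (x, y) ∈ C → G i x y = H i x y)
    (hTS : ∀ i x y, (x, y) ∈ C → T i x y = S i x y)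
    {x y : Vec n} (h : (x, y) ∈ C) (i k : Fin n) :
    horizDeriv G T i k x y = horizDeriv H S i k x y := by
  have e1 : ∀ j k x y, (x, y) ∈ C → dY k (G j) x y = dY k (H j) x y :=
    fun j k x y h => (isDerivation_dY hC k).congr (hGH j) h
  simp only [horizDeriv, (isDerivation_dX hC k).congr (hTS i) h, hTS _ x y h, e1 _ _ x y h,
    (isDerivation_dY hC _).congr (e1 _ _) h, (isDerivation_dY hC _).congr (hTS _) h]

lemma Induces.congr {L : Vec n → Vec n → ℝ} (hG : Induces C L G)
    (hGH : ∀ i x y, (x, y) ∈ C → H i x y = G i x y) : Induces C L H :=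
  ⟨hG.1, fun x y h i => (hGH i x y h).trans (hG.2 x y h i)⟩

/-- In dimension at least two, a curvature of the form `Rⁱₖ = R δⁱₖ - τₖ yⁱ` determines `τ`. -/
lemma HasScalarCurvature.tau_unique (hn : 2 ≤ n) {R R' : Vec n → Vec n → ℝ}
    {τ τ' : Fin n → Vec n → Vec n → ℝ} (h : HasScalarCurvature C G R τ)
    (h' : HasScalarCurvature C G R' τ') (hC : C ⊆ {p | p.2 ≠ 0}) {x y : Vec n}
    (hxy : (x, y) ∈ C) (k : Fin n) : τ k x y = τ' k x y := by
  have e : ∀ i k, (τ k x y - τ' k x y) * y i = (R x y - R' x y) * (if i = k then 1 else 0) := by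
    intro i k
    have := (h.curv_eq x y hxy i k).symm.trans (h'.curv_eq x y hxy i k)
    linear_combination -this
  -- In row `i` the off-diagonal entries determine every `τⱼ` with `j ≠ i`; the diagonal entry at
  -- such a `j` then determines `R`, and with it the remaining `τᵢ`.
  obtain ⟨i, hi⟩ : ∃ i, y i ≠ 0 := Function.ne_iff.1 (hC hxy)
  have off : ∀ j, j ≠ i → τ j x y - τ' j x y = 0 := by
    intro j hj
    have := e i j
    rw [if_neg hj.symm, mul_zero] at this
    exact (mul_eq_zero.1 this).resolve_right hi
  have : Nontrivial (Fin n) := Fin.nontrivial_iff_two_le.2 hn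
  obtain ⟨j, hj⟩ := exists_ne i
  have hR : R x y - R' x y = 0 := by
    have := e j j
    rw [off j hj] at this
    simpa using this.symm
  have := e i k
  rw [hR, zero_mul] at this
  exact sub_eq_zero.1 ((mul_eq_zero.1 this).resolve_right hi)

end Congruence

/-! ### Sprays built from a pair `a`, `b` satisfying the two first-order equations -/

section FunkPair

variable {C : Set (Vec n × Vec n)} {a b : Vec n → Vec n → ℝ}

/-- The projective factor `½ a + c b`. -/
def projFactor (a b : Vec n → Vec n → ℝ) (c : ℝ) (x y : Vec n) : ℝ :=
  1 / 2 * a x y + c * b x y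

/-- The Ricci scalar of the spray with projective factor `½ a + c b`. -/
def ricciScalar (a b : Vec n → Vec n → ℝ) (c : ℝ) (x y : Vec n) : ℝ :=
  -1 / 4 * (a x y * a x y) + c * (a x y * b x y) + (c ^ 2 + c) * (b x y * b x y)

/-- The cubic form `a b² + κ b³`. -/
def cubicForm (a b : Vec n → Vec n → ℝ) (κ : ℝ) (x y : Vec n) : ℝ :=
  a x y * (b x y * b x y) + κ * (b x y * (b x y * b x y))

lemma smooth_projFactor (ha : SmoothOnTangent C a) (hb : SmoothOnTangent C b) (c : ℝ) :
    SmoothOnTangent C (projFactor a b c) := (ha.const_mul _).add (hb.const_mul c)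

lemma smooth_ricciScalar (ha : SmoothOnTangent C a) (hb : SmoothOnTangent C b) (c : ℝ) :
    SmoothOnTangent C (ricciScalar a b c) :=
  (((ha.mul ha).const_mul _).add ((ha.mul hb).const_mul _)).add ((hb.mul hb).const_mul _)

lemma smooth_cubicForm (ha : SmoothOnTangent C a) (hb : SmoothOnTangent C b) (κ : ℝ) :
    SmoothOnTangent C (cubicForm a b κ) :=
  (ha.mul (hb.mul hb)).add ((hb.mul (hb.mul hb)).const_mul κ)

lemma homog_projFactor (ha : PosHomogOn C 1 a) (hb : PosHomogOn C 1 b) (c : ℝ) :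
    PosHomogOn C 1 (projFactor a b c) := by
  intro x y h t ht
  simp only [projFactor, ha x y h t ht, hb x y h t ht]
  ring

lemma homog_ricciScalar (ha : PosHomogOn C 1 a) (hb : PosHomogOn C 1 b) (c : ℝ) :
    PosHomogOn C 2 (ricciScalar a b c) := by
  intro x y h t ht
  simp only [ricciScalar, ha x y h t ht, hb x y h t ht]
  ring

lemma homog_cubicForm (ha : PosHomogOn C 1 a) (hb : PosHomogOn C 1 b) (κ : ℝ) :
    PosHomogOn C 3 (cubicForm a b κ) := by
  intro x y h t ht
  simp only [cubicForm, ha x y h t ht, hb x y h t ht]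
  ring

namespace IsDerivation

variable {D : (Vec n → Vec n → ℝ) → Vec n → Vec n → ℝ}

lemma projFactor (hD : IsDerivation C D) (ha : SmoothOnTangent C a) (hb : SmoothOnTangent C b)
    (c : ℝ) {x y : Vec n} (h : (x, y) ∈ C) :
    D (projFactor a b c) x y = 1 / 2 * D a x y + c * D b x y := by
  unfold _root_.projFactor
  rw [hD.add (ha.const_mul _) (hb.const_mul _) h, hD.const_mul _ ha h, hD.const_mul _ hb h]

lemma ricciScalar (hD : IsDerivation C D) (ha : SmoothOnTangent C a) (hb : SmoothOnTangent C b)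
    (c : ℝ) {x y : Vec n} (h : (x, y) ∈ C) :
    D (ricciScalar a b c) x y = (-1 / 2 * a x y + c * b x y) * D a x y
      + (c * a x y + 2 * (c ^ 2 + c) * b x y) * D b x y := by
  unfold _root_.ricciScalar
  rw [hD.add (((ha.mul ha).const_mul _).add ((ha.mul hb).const_mul _)) ((hb.mul hb).const_mul _) h,
    hD.add ((ha.mul ha).const_mul _) ((ha.mul hb).const_mul _) h, hD.const_mul _ (ha.mul ha) h,
    hD.const_mul _ (ha.mul hb) h, hD.const_mul _ (hb.mul hb) h, hD.mul ha ha h, hD.mul ha hb h,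
    hD.mul hb hb h]
  ring

lemma cubicForm (hD : IsDerivation C D) (ha : SmoothOnTangent C a) (hb : SmoothOnTangent C b)
    (κ : ℝ) {x y : Vec n} (h : (x, y) ∈ C) :
    D (cubicForm a b κ) x y = b x y * b x y * D a x y
      + (2 * a x y * b x y + 3 * κ * (b x y * b x y)) * D b x y := by
  unfold _root_.cubicForm
  rw [hD.add (ha.mul (hb.mul hb)) ((hb.mul (hb.mul hb)).const_mul _) h,
    hD.const_mul _ (hb.mul (hb.mul hb)) h, hD.mul ha (hb.mul hb) h, hD.mul hb (hb.mul hb) h,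
    hD.mul hb hb h]
  ring

end IsDerivation

lemma dX_projFactor (hC : IsOpen C) (ha : SmoothOnTangent C a) (hb : SmoothOnTangent C b)
    (hax : ∀ x y, (x, y) ∈ C → ∀ k, dX k a x y = a x y * dY k a x y)
    (hbx : ∀ x y, (x, y) ∈ C → ∀ k, dX k b x y = -(b x y * dY k b x y)) (c : ℝ)
    {x y : Vec n} (h : (x, y) ∈ C) (k : Fin n) :
    dX k (projFactor a b c) x y = projFactor a b c x y * dY k (projFactor a b c) x y
      - 1 / 2 * dY k (ricciScalar a b c) x y := by
  rw [(isDerivation_dX hC k).projFactor ha hb c h, (isDerivation_dY hC k).projFactor ha hb c h,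
    (isDerivation_dY hC k).ricciScalar ha hb c h, hax x y h, hbx x y h, projFactor]
  ring

/-- Once the `x`-derivatives are replaced by `y`-derivatives this is a polynomial identity. The
factor `c (2 c + 1)` is where the two exceptional values of `c` come from. -/
lemma horizontal_ricciScalar (hC : IsOpen C) (ha : SmoothOnTangent C a) (hb : SmoothOnTangent C b)
    (hax : ∀ x y, (x, y) ∈ C → ∀ k, dX k a x y = a x y * dY k a x y)
    (hbx : ∀ x y, (x, y) ∈ C → ∀ k, dX k b x y = -(b x y * dY k b x y)) (c : ℝ)
    {x y : Vec n} (h : (x, y) ∈ C) (k : Fin n) :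
    dX k (ricciScalar a b c) x y - 2 * (dY k (projFactor a b c) x y * ricciScalar a b c x y)
      - projFactor a b c x y * dY k (ricciScalar a b c) x y =
      -(c * (2 * c + 1)) * dY k (cubicForm a b (2 / 3 * (c + 1))) x y := by
  rw [(isDerivation_dX hC k).ricciScalar ha hb c h, (isDerivation_dY hC k).projFactor ha hb c h,
    (isDerivation_dY hC k).ricciScalar ha hb c h, (isDerivation_dY hC k).cubicForm ha hb _ h,
    hax x y h, hbx x y h, projFactor, ricciScalar]
  ring

lemma hasScalarCurvature_projFactor (hC : IsOpen C) (ha : SmoothOnTangent C a)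
    (hb : SmoothOnTangent C b) (ha1 : PosHomogOn C 1 a) (hb1 : PosHomogOn C 1 b)
    (hax : ∀ x y, (x, y) ∈ C → ∀ k, dX k a x y = a x y * dY k a x y)
    (hbx : ∀ x y, (x, y) ∈ C → ∀ k, dX k b x y = -(b x y * dY k b x y)) (c : ℝ) :
    HasScalarCurvature C (fun i x y => projFactor a b c x y * y i) (ricciScalar a b c)
      (fun k x y => dY k (ricciScalar a b c) x y / 2) where
  smooth_R := smooth_ricciScalar ha hb c
  smooth_τ k := (((smooth_ricciScalar ha hb c).dY hC k).const_mul (1 / 2)).congr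
    fun x y _ => by ring
  homog_R := homog_ricciScalar ha1 hb1 c
  homog_τ k x y h t ht := by
    beta_reduce
    rw [PosHomogOn.dY hC (smooth_ricciScalar ha hb c) (homog_ricciScalar ha1 hb1 c) k x y h t ht]
    ring
  curv_eq x y h i k := riemannCurv_mul_coord hC (smooth_projFactor ha hb c)
    (homog_projFactor ha1 hb1 c) (smooth_ricciScalar ha hb c) (homog_ricciScalar ha1 hb1 c)
    (fun x y h k => by rw [dX_projFactor hC ha hb hax hbx c h]; ring) h i k

/-- Uniqueness of `τ` reduces any witness to `Ξ_{yᵏ}/2`, whose horizontal derivative is a multiple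
of the Hessian of the cubic form. -/
lemma isConstantCurvature_projFactor_iff (hn : 2 ≤ n) (hC : IsOpen C) (hne : C.Nonempty)
    (hC0 : C ⊆ {p | p.2 ≠ 0}) (ha : SmoothOnTangent C a)
    (hb : SmoothOnTangent C b) (ha1 : PosHomogOn C 1 a) (hb1 : PosHomogOn C 1 b)
    (ha0 : ∀ x y, (x, y) ∈ C → 0 < a x y) (hb0 : ∀ x y, (x, y) ∈ C → 0 < b x y)
    (hax : ∀ x y, (x, y) ∈ C → ∀ k, dX k a x y = a x y * dY k a x y)
    (hbx : ∀ x y, (x, y) ∈ C → ∀ k, dX k b x y = -(b x y * dY k b x y)) (c : ℝ) :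
    IsConstantCurvature C (fun i x y => projFactor a b c x y * y i) ↔ c * (2 * c + 1) = 0 := by
  have hsc := hasScalarCurvature_projFactor hC ha hb ha1 hb1 hax hbx c
  set A := cubicForm a b (2 / 3 * (c + 1))
  have sA : SmoothOnTangent C A := smooth_cubicForm ha hb _
  have hA3 : PosHomogOn C 3 A := homog_cubicForm ha1 hb1 _
  have hd : ∀ x y, (x, y) ∈ C → ∀ i k, horizDeriv (fun i x y => projFactor a b c x y * y i)
      (fun k x y => dY k (ricciScalar a b c) x y / 2) i k x y =
      -(c * (2 * c + 1)) * dY i (dY k A) x y / 2 := by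
    intro x y h i k
    rw [horizDeriv_half_dY hC (smooth_projFactor ha hb c) (smooth_ricciScalar ha hb c)
      (homog_ricciScalar ha1 hb1 c) h, (isDerivation_dY hC i).congr
      (fun x y h => horizontal_ricciScalar hC ha hb hax hbx c h k) h,
      (isDerivation_dY hC i).const_mul _ (sA.dY hC k) h]
  constructor
  · rintro ⟨R, τ, hs, hτ⟩
    by_contra hc
    refine not_forall_cubic_eq_zero hC hne hb hb1 ha0 hb0 hax hbx (2 / 3 * (c + 1))
      fun x y h => ?_
    have e0 : ∀ i k, dY i (dY k A) x y = 0 := by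
      intro i k
      have := hτ x y h i k
      rw [horizDeriv_congr hC (fun _ _ _ _ => rfl)
        (fun i x y h => hs.tau_unique hn hsc hC0 h i) h, hd x y h] at this
      have h2 : c * (2 * c + 1) * dY i (dY k A) x y = 0 := by linarith
      exact (mul_eq_zero.1 h2).resolve_left hc
    have e1 : ∑ j, y j * dY j A x y = 3 * A x y := by simpa using hA3.euler hC sA h
    -- Euler's relation in degree two, then in degree three, descends from a zero Hessian to `A =
    -- 0`.
    have e2 : ∀ k, dY k A x y = 0 := by
      intro k
      have : ∑ j, y j * dY j (dY k A) x y = 2 * dY k A x y := by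
        simpa using PosHomogOn.euler_dY (d := 2) hC sA hA3 h k
      simp only [e0, mul_zero, Finset.sum_const_zero] at this
      linarith
    simp only [e2, mul_zero, Finset.sum_const_zero] at e1
    have : A x y = 0 := by linarith
    exact this
  · intro hc
    refine ⟨_, _, hsc, fun x y h i k => ?_⟩
    rw [hd x y h, hc]
    ring

/-- A spray with projective factor `½ a + c b`, `c (2 c + 1) ≠ 0`, is not induced by any Finsler
metric on a non-empty open set. -/
lemma not_induces_projFactor (hn : 2 ≤ n) (hC : IsOpen C) (hne : C.Nonempty)
    (ha : SmoothOnTangent C a)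
    (hb : SmoothOnTangent C b) (ha1 : PosHomogOn C 1 a) (hb1 : PosHomogOn C 1 b)
    (ha0 : ∀ x y, (x, y) ∈ C → 0 < a x y) (hb0 : ∀ x y, (x, y) ∈ C → 0 < b x y)
    (hax : ∀ x y, (x, y) ∈ C → ∀ k, dX k a x y = a x y * dY k a x y)
    (hbx : ∀ x y, (x, y) ∈ C → ∀ k, dX k b x y = -(b x y * dY k b x y)) {c : ℝ}
    (hc : c * (2 * c + 1) ≠ 0) (L : Vec n → Vec n → ℝ) :
    ¬ Induces C L (fun i x y => projFactor a b c x y * y i) := by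
  intro hL
  obtain ⟨x₀, y₀, h₀, hL₀⟩ := hL.1.exists_ne_zero hn hC hne
  -- `A` is known to vanish only where `L ≠ 0`, but `not_forall_cubic_eq_zero` needs just some
  -- non-empty open set.
  set C' : Set (Vec n × Vec n) := C ∩ (fun p : Vec n × Vec n => L p.1 p.2) ⁻¹' {0}ᶜ
  have hC' : IsOpen C' := (ContDiffOn.continuousOn hL.1.smooth).isOpen_inter_preimage hC
    isOpen_compl_singleton
  have hsub : C' ⊆ C := Set.inter_subset_left
  refine not_forall_cubic_eq_zero hC' ⟨(x₀, y₀), h₀, hL₀⟩ (hb.mono hsub) (hb1.mono hsub)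
    (fun x y h => ha0 x y h.1) (fun x y h => hb0 x y h.1) (fun x y h => hax x y h.1)
    (fun x y h => hbx x y h.1) (2 / 3 * (c + 1)) fun x y h => ?_
  exact eq_zero_of_horizontally_constant hn hC (smooth_projFactor ha hb c)
    (smooth_ricciScalar ha hb c) (homog_ricciScalar ha1 hb1 c) (smooth_cubicForm ha hb _)
    (homog_cubicForm ha1 hb1 _) (neg_ne_zero.2 hc)
    (fun x y h k => dX_projFactor hC ha hb hax hbx c h k)
    (fun x y h k => horizontal_ricciScalar hC ha hb hax hbx c h k) hL.1
    (fun x y h k => hL.dX_eq hC (smooth_projFactor ha hb c) h k) h.1 h.2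

end FunkPair

/-! ### The Klein metric and the two metrizable cases -/

section Klein

variable {Ω : Set (Vec n)} {F : Vec n → Vec n → ℝ}

lemma kleinMetric_eq (F : Vec n → Vec n → ℝ) :
    kleinMetric F = projFactor F (reverse F) (1 / 2) := by
  ext x y
  simp only [kleinMetric, projFactor, reverse]
  ring

namespace IsFunkMetric

lemma reverse_pos (hF : IsFunkMetric Ω F) {x y : Vec n} (h : (x, y) ∈ slitTangent Ω) :
    0 < reverse F x y := hF.pos x (-y) (neg_mem_slitTangent h)

lemma kleinMetric_pos (hF : IsFunkMetric Ω F) {x y : Vec n} (h : (x, y) ∈ slitTangent Ω) :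
    0 < kleinMetric F x y := half_pos (add_pos (hF.pos x y h) (hF.reverse_pos h))

lemma hessian_nonneg (hF : IsFunkMetric Ω F) (hopen : IsOpen Ω) (hconv : Convex ℝ Ω)
    {x y : Vec n} (h : (x, y) ∈ slitTangent Ω) (v : Vec n) :
    0 ≤ ∑ i, ∑ j, v i * v j * dY j (dY i F) x y :=
  hessian_nonneg_of_subadditive (isOpen_slitTangent hopen) hF.smooth hF.homog h.1
    (hF.subadditive hopen hconv h.1) h.2 v

lemma hessian_reverse_nonneg (hF : IsFunkMetric Ω F) (hopen : IsOpen Ω) (hconv : Convex ℝ Ω)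
    {x y : Vec n} (h : (x, y) ∈ slitTangent Ω) (v : Vec n) :
    0 ≤ ∑ i, ∑ j, v i * v j * dY j (dY i (reverse F)) x y := by
  refine hessian_nonneg_of_subadditive (isOpen_slitTangent hopen) hF.smooth.reverse
    hF.homog.reverse h.1 (fun y z hy hz hyz => ?_) h.2 v
  have := hF.subadditive hopen hconv h.1 (-y) (-z) (neg_ne_zero.2 hy) (neg_ne_zero.2 hz)
    (by rw [← neg_add]; exact neg_ne_zero.2 hyz)
  rwa [← neg_add] at this

/-- A kernel vector `v` of the fundamental tensor annihilates both the differential and the Hessian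
form of the Klein metric. The latter is half the sum of two non-negative forms, so that of `F`
vanishes at `v` too and `v` is radial; by Euler's relation the differential kills no non-zero radial
vector. -/
lemma kleinMetric_isFinslerMetric (hF : IsFunkMetric Ω F) (hopen : IsOpen Ω)
    (hconv : Convex ℝ Ω) :
    IsFinslerMetric (slitTangent Ω) (fun x y => kleinMetric F x y ^ 2) := by
  have hC := isOpen_slitTangent hopen
  have sK : SmoothOnTangent (slitTangent Ω) (kleinMetric F) := by
    rw [kleinMetric_eq]; exact smooth_projFactor hF.smooth hF.smooth.reverse _
  have hK1 : PosHomogOn (slitTangent Ω) 1 (kleinMetric F) := by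
    rw [kleinMetric_eq]; exact homog_projFactor hF.homog hF.homog.reverse _
  refine ⟨(sK.mul sK).congr fun x y _ => by ring, fun x y h t ht => ?_, fun x y h hdet => ?_⟩
  · simp only [hK1 x y h t ht]
    ring
  obtain ⟨v, hv0, hv⟩ := Matrix.exists_mulVec_eq_zero_iff.2 hdet
  have hq := dotProduct_fundTensor_sq hC sK h v
  rw [hv, dotProduct_zero] at hq
  have dK : ∀ i j, dY j (dY i (kleinMetric F)) x y =
      1 / 2 * dY j (dY i F) x y + 1 / 2 * dY j (dY i (reverse F)) x y := by
    intro i j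
    rw [kleinMetric_eq, (isDerivation_dY hC j).congr (fun x y h =>
      (isDerivation_dY hC i).projFactor hF.smooth hF.smooth.reverse (1 / 2) h) h]
    exact (isDerivation_dY hC j).projFactor (hF.smooth.dY hC i) (hF.smooth.reverse.dY hC i) _ h
  have hQ : ∑ i, ∑ j, v i * v j * dY j (dY i (kleinMetric F)) x y =
      1 / 2 * (∑ i, ∑ j, v i * v j * dY j (dY i F) x y)
        + 1 / 2 * ∑ i, ∑ j, v i * v j * dY j (dY i (reverse F)) x y := by
    simp only [Finset.mul_sum]
    rw [← Finset.sum_add_distrib]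
    refine Finset.sum_congr rfl fun i _ => ?_
    rw [← Finset.sum_add_distrib]
    exact Finset.sum_congr rfl fun j _ => by rw [dK]; ring
  have hQa := hF.hessian_nonneg hopen hconv h v
  have hQb := hF.hessian_reverse_nonneg hopen hconv h v
  have hpos := hF.kleinMetric_pos h
  have hsq := sq_nonneg (∑ i, v i * dY i (kleinMetric F) x y)
  have hQ0 : ∑ i, ∑ j, v i * v j * dY j (dY i (kleinMetric F)) x y = 0 := by
    refine le_antisymm ?_ (by rw [hQ]; linarith)
    by_contra! hlt
    linarith [mul_pos hpos hlt]
  rw [hQ0, mul_zero, zero_add] at hq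
  have hl : ∑ i, v i * dY i (kleinMetric F) x y = 0 := by simpa using hq.symm
  obtain ⟨t, rfl⟩ := eq_smul_of_hessian_eq_zero hC hF.smooth hF.homog h (hF.pos x y h)
    (hF.finsler.nondegenerate x y h) (fun w => hF.hessian_nonneg hopen hconv h w) v (by linarith)
  have e1 : ∑ j, y j * dY j (kleinMetric F) x y = kleinMetric F x y := by
    simpa using hK1.euler hC sK h
  have e2 : t * ∑ j, y j * dY j (kleinMetric F) x y = 0 := by
    rw [Finset.mul_sum, ← hl]
    exact Finset.sum_congr rfl fun j _ => by simp; ring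
  rw [e1] at e2
  refine hv0 ?_
  rw [(mul_eq_zero.1 e2).resolve_right hpos.ne', zero_smul]

lemma induces_funk (hF : IsFunkMetric Ω F) (hopen : IsOpen Ω) (hconv : Convex ℝ Ω) :
    Induces (slitTangent Ω) (fun x y => F x y ^ 2)
      (fun i x y => projFactor F (reverse F) 0 x y * y i) := by
  have hC := isOpen_slitTangent hopen
  have sF := hF.smooth
  refine induces_mul_coord hC (smooth_projFactor sF sF.reverse 0)
    (homog_projFactor hF.homog hF.homog.reverse 0) hF.finsler fun x y h k => ?_
  have hsq : (fun x y => F x y ^ 2) = fun x y => F x y * F x y := by ext; ring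
  rw [hsq, (isDerivation_dX hC k).mul sF sF h, (isDerivation_dY hC k).mul sF sF h,
    (isDerivation_dY hC k).projFactor sF sF.reverse _ h, hF.dX_eq hopen hconv h, projFactor]
  ring

lemma induces_klein (hF : IsFunkMetric Ω F) (hopen : IsOpen Ω) (hconv : Convex ℝ Ω) :
    Induces (slitTangent Ω) (fun x y => kleinMetric F x y ^ 2)
      (fun i x y => projFactor F (reverse F) (-1 / 2) x y * y i) := by
  have hC := isOpen_slitTangent hopen
  have sF := hF.smooth
  refine induces_mul_coord hC (smooth_projFactor sF sF.reverse _)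
    (homog_projFactor hF.homog hF.homog.reverse _)
    (hF.kleinMetric_isFinslerMetric hopen hconv) fun x y h k => ?_
  have sK := smooth_projFactor sF sF.reverse (1 / 2)
  have hsq : (fun x y => kleinMetric F x y ^ 2) = fun x y =>
      projFactor F (reverse F) (1 / 2) x y * projFactor F (reverse F) (1 / 2) x y := by
    rw [kleinMetric_eq]; ext; ring
  rw [hsq, (isDerivation_dX hC k).mul sK sK h, (isDerivation_dY hC k).mul sK sK h,
    (isDerivation_dY hC k).projFactor sF sF.reverse _ h,
    (isDerivation_dY hC k).projFactor sF sF.reverse _ h,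
    (isDerivation_dX hC k).projFactor sF sF.reverse _ h, hF.dX_eq hopen hconv h,
    hF.dX_reverse hopen hconv h]
  simp only [kleinMetric_eq, projFactor]
  ring

/-- The case `c = 0` identifies the spray of `F` as `(F/2) yⁱ`; the added term is already
proportional to `yⁱ`. -/
lemma modifiedSpray_eq (hF : IsFunkMetric Ω F) (hopen : IsOpen Ω) (hconv : Convex ℝ Ω) (c : ℝ)
    (i : Fin n) (x y : Vec n) (h : (x, y) ∈ slitTangent Ω) :
    modifiedSpray F c i x y = projFactor F (reverse F) c x y * y i := by
  rw [modifiedSpray, ← (hF.induces_funk hopen hconv).2 x y h i]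
  simp only [projFactor, reverse]
  ring

end IsFunkMetric

lemma isConicalRegion_slitTangent (hn : 2 ≤ n) (hopen : IsOpen Ω) :
    IsConicalRegion Ω (slitTangent Ω) where
  isOpen := isOpen_slitTangent hopen
  subset := subset_rfl
  smul_mem x y h t ht := ⟨h.1, smul_ne_zero ht.ne' h.2⟩
  fibre_nonempty x hx := by
    have : Nonempty (Fin n) := Fin.pos_iff_nonempty.1 (by omega)
    obtain ⟨y, hy⟩ := exists_ne (0 : Vec n)
    exact ⟨y, hx, hy⟩

end Klein

end

theorem theorem1p1 (n : ℕ) (hn : 2 ≤ n) (Ω : Set (Vec n)) (hne : Ω.Nonempty) (hopen : IsOpen Ω)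
    (hconv : Convex ℝ Ω) (F : Vec n → Vec n → ℝ) (hF : IsFunkMetric Ω F) (c : ℝ) :
    IsSpray (slitTangent Ω) (modifiedSpray F c) ∧
    IsIsotropicCurvature (slitTangent Ω) (modifiedSpray F c) ∧
    (IsConstantCurvature (slitTangent Ω) (modifiedSpray F c) ↔ c = 0 ∨ c = -1 / 2) ∧
    (LocallyMetrizableOn Ω (modifiedSpray F c) ↔ c = 0 ∨ c = -1 / 2) ∧
    (MetrizableOn Ω (modifiedSpray F c) ↔ c = 0 ∨ c = -1 / 2) ∧
    (c = 0 → Induces (slitTangent Ω) (fun x y => F x y ^ 2) (modifiedSpray F c)) ∧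
    (c = -1 / 2 →
      Induces (slitTangent Ω) (fun x y => kleinMetric F x y ^ 2) (modifiedSpray F c)) := by
  have hcone := isConicalRegion_slitTangent hn hopen
  have hC := hcone.isOpen
  have sF := hF.smooth
  have sB := hF.smooth.reverse
  have hax := fun x y (h : (x, y) ∈ slitTangent Ω) k => hF.dX_eq hopen hconv h k
  have hbx := fun x y (h : (x, y) ∈ slitTangent Ω) k => hF.dX_reverse hopen hconv h k
  have hb0 := fun x y (h : (x, y) ∈ slitTangent Ω) => hF.reverse_pos h
  have hG := hF.modifiedSpray_eq hopen hconv c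
  have hroot : c * (2 * c + 1) = 0 ↔ c = 0 ∨ c = -1 / 2 := by
    rw [mul_eq_zero]
    refine or_congr Iff.rfl ⟨fun h => by linarith, fun h => by linarith⟩
  have hCne : (slitTangent Ω).Nonempty := by
    obtain ⟨x, hx⟩ := hne
    obtain ⟨y, hy⟩ := hcone.fibre_nonempty x hx
    exact ⟨_, hy⟩
  have hsc := hasScalarCurvature_projFactor hC sF sB hF.homog hF.homog.reverse hax hbx c
  have curv := fun x y (h : (x, y) ∈ slitTangent Ω) i k => riemannCurv_congr hC hG h i k
  have hfunk : c = 0 → Induces (slitTangent Ω) (fun x y => F x y ^ 2) (modifiedSpray F c) := by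
    rintro rfl
    exact (hF.induces_funk hopen hconv).congr hG
  have hklein : c = -1 / 2 →
      Induces (slitTangent Ω) (fun x y => kleinMetric F x y ^ 2) (modifiedSpray F c) := by
    rintro rfl
    exact (hF.induces_klein hopen hconv).congr hG
  have hmet : c = 0 ∨ c = -1 / 2 → MetrizableOn Ω (modifiedSpray F c) := by
    rintro (h | h)
    · exact ⟨_, _, hcone, hfunk h⟩
    · exact ⟨_, _, hcone, hklein h⟩
  -- The obstruction is local, so one statement over arbitrary non-empty `U` serves both local and
  -- global metrizability.
  have hnot : ∀ U ⊆ Ω, U.Nonempty → MetrizableOn U (modifiedSpray F c) → c = 0 ∨ c = -1 / 2 := by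
    rintro U hU ⟨x, hx⟩ ⟨C, L, hCU, hL⟩
    by_contra hc
    have hsub : C ⊆ slitTangent Ω := fun p hp => ⟨hU (hCU.subset hp).1, (hCU.subset hp).2⟩
    obtain ⟨y, hy⟩ := hCU.fibre_nonempty x hx
    exact not_induces_projFactor hn hCU.isOpen ⟨_, hy⟩ (sF.mono hsub) (sB.mono hsub)
      (hF.homog.mono hsub) (hF.homog.reverse.mono hsub) (fun x y h => hF.pos x y (hsub h))
      (fun x y h => hb0 x y (hsub h)) (fun x y h => hax x y (hsub h))
      (fun x y h => hbx x y (hsub h)) (fun h => hc (hroot.1 h)) L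
      (hL.congr fun i x y h => (hG i x y (hsub h)).symm)
  refine ⟨fun i => ⟨?_, ?_⟩, ⟨ricciScalar F (reverse F) c, _, ⟨hsc.smooth_R, hsc.smooth_τ,
    hsc.homog_R, hsc.homog_τ, fun x y h i k => (curv x y h i k).trans (hsc.curv_eq x y h i k)⟩,
    fun x y _ i => by ring⟩, ?_, ⟨?_, fun h x hx => ⟨Ω, hopen, hx, subset_rfl, hmet h⟩⟩,
    ⟨hnot Ω subset_rfl hne, hmet⟩, hfunk, hklein⟩
  · exact (smoothOnTangent_mul_coord (smooth_projFactor sF sB c) i).congr (hG i)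
  · intro x y h t ht
    rw [hG i x y h, hG i x (t • y) (hcone.smul_mem x y h t ht),
      homog_projFactor hF.homog hF.homog.reverse c x y h t ht, Pi.smul_apply, smul_eq_mul]
    ring
  · rw [← hroot, ← isConstantCurvature_projFactor_iff hn hC hCne (fun p hp => hp.2) sF sB hF.homog
      hF.homog.reverse hF.pos hb0 hax hbx c]
    constructor
    · rintro ⟨R, τ, hs, hτ⟩
      refine ⟨R, τ, ⟨hs.smooth_R, hs.smooth_τ, hs.homog_R, hs.homog_τ, fun x y h i k =>
        (curv x y h i k).symm.trans (hs.curv_eq x y h i k)⟩, fun x y h i k => ?_⟩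
      rw [← hτ x y h i k]
      exact (horizDeriv_congr hC hG (fun _ _ _ _ => rfl) h i k).symm
    · rintro ⟨R, τ, hs, hτ⟩
      refine ⟨R, τ, ⟨hs.smooth_R, hs.smooth_τ, hs.homog_R, hs.homog_τ, fun x y h i k =>
        (curv x y h i k).trans (hs.curv_eq x y h i k)⟩, fun x y h i k => ?_⟩
      rw [← hτ x y h i k]
      exact horizDeriv_congr hC hG (fun _ _ _ _ => rfl) h i k
  · intro h
    obtain ⟨x, hx⟩ := hne
    obtain ⟨U, _, hxU, hU, hm⟩ := h x hx
    exact hnot U hU ⟨x, hxU⟩ hm
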